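/- Let $S$ be a connected complex manifold and let $(\mathcal V_{\mathbf R},W_\bullet,\mathcal F^\bullet,(Q_k)_k)$ be a graded-polarized variation of real mixed Hodge structures over $S$: $\mathcal V_{\mathbf R}$ is a local system of finite-dimensional real vector spaces, $W_\bullet$ a finite increasing filtration by sub-local systems, $\mathcal F^\bullet$ a finite decreasing filtration of $\mathcal V=\mathcal O_S\otimes\mathcal V_{\mathbf R}$ by holomorphic subbundles satisfying Griffiths transversality, $Q_k$ a flat bilinear form on $Gr^W_k\mathcal V_{\mathbf R}$, and for each $k$ the filtration induced by $\mathcal F^\bullet$ together with $Q_k$ makes $Gr^W_k$ a polarized variation of Hodge structures of weight $k$. For a real mixed Hodge structure $H=(V,W_\bullet,F^\bullet)$ put $h^{p,q}_H=\dim_{\mathbf C}Gr_F^pGr^W_{p+q}V_{\mathbf C}$, $s^{p,q}_H=\dim_{\mathbf C}Gr_F^pGr_{\overline F}^qV_{\mathbf C}$, and let $$\alpha(H)=\tfrac12\sum_{p,q\in\mathbf Z}(p+q)^2\,(h^{p,q}_H-s^{p,q}_H)$$ be its level of $\mathbf R$-splitting. Let $\pi:\widetilde S\to S$ be a universal covering,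 $\tilde s_0\in\widetilde S$, $s_0=\pi(\tilde s_0)$, and let $\mathcal M$ be the classifying space of all Hodge filtrations $F^\bullet$ on $\mathcal V_{s_0}$ that together with $W_{\bullet,s_0}$ form a mixed Hodge structure graded-polarized by the forms $Q_{k,s_0}$ and having the Hodge numbers $h^{p,q}$ of the fibre at $s_0$; $\mathcal M$ carries the topology induced from the variety of flags in $\mathcal V_{s_0}$ (inside a product of Grassmannians). Say that a function $a$ on a topological space $X$ is a *semicontinuous level function* if it takes integer values, is lower semicontinuous, and its level sets $X_n=\{a=n\}$, $n\in\mathbf Z$, stratify $X$: $X=\coprod_n X_n$, only finitely many $X_n$ are nonempty, each $X_n$ is locally closed, and $\overline{X_n}\subset\bigcup_{m\le n}X_m$. Then: 1. on $\mathcal M\times\mathcal M$ the function $(F_1,F_2)\mapsto\frac12\sum_{p,q}(p+q)^2\bigl(h^{p,q}-\dim_{\mathbf C}Gr_{F_1}^pGr_{F_2}^q\mathcal V_{s_0}\bigr)$ is a semicontinuous level function; 2. on $\mathcal M$ the function $F\mapsto\alpha(\mathcal V_{s_0},W_{\bullet,s_0},F)$ is a semicontinuous level function; 3. there is a continuous map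 $\widetilde\Phi:\widetilde S\to\mathcal M$ (the lifted period map) and a flat trivialization $\tau$ of $\pi^*\mathcal V_{\mathbf R}$ with fibre $\mathcal V_{\mathbf R,s_0}$, equal to the identity at $\tilde s_0$ and compatible with $W_\bullet$, such that $\widetilde\Phi(t)=\tau_t(\mathcal F^\bullet_{\pi(t)})$, and $\alpha$ of the fibre at $\pi(t)$ equals $\alpha$ of the point $\widetilde\Phi(t)$ for all $t\in\widetilde S$; 4. on $\widetilde S$ the function $t\mapsto\alpha(\mathcal V_{\pi(t)})$ is a semicontinuous level function; in particular $\widetilde S=\coprod_n\widetilde S_n$ is stratified by the level of $\mathbf R$-splitting. -/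

import Mathlib

open scoped TensorProduct Manifold ContDiff Topology

noncomputable section

namespace SplitLevel

universe u v w

/-! ### Filtered vector spaces -/

section Filtrations

variable {A : Type*} [AddCommGroup A] [Module ℂ A]

/-- The graded piece `Gr_F^p = F^p / F^{p+1}` of a decreasing filtration. -/
abbrev Gr (F : ℤ → Submodule ℂ A) (p : ℤ) : Type _ :=
  F p ⧸ (F (p + 1)).submoduleOf (F p)

/-- The filtration induced by `F` on `Gr_G^q`: the image of `F^p ∩ G^q`. -/
def inducedGr (F G : ℤ → Submodule ℂ A) (q p : ℤ) : Submodule ℂ (Gr G q) :=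
  ((F p).submoduleOf (G q)).map ((G (q + 1)).submoduleOf (G q)).mkQ

/-- `dim Gr_F^p Gr_G^q`. -/
def bigradedDim (F G : ℤ → Submodule ℂ A) (p q : ℤ) : ℕ :=
  Module.finrank ℂ (Gr (inducedGr F G q) p)

/-- Half the sum over all `p, q` of `(p + q)² (h^{p,q} - dim Gr_F^p Gr_G^q)`. The family has finite
support when `h` has finite support and the filtrations are finite. -/
def pairLevel (h : ℤ → ℤ → ℕ) (F G : ℤ → Submodule ℂ A) : ℚ :=
  (1 / 2) * ∑ᶠ pq : ℤ × ℤ,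
    ((pq.1 + pq.2 : ℤ) : ℚ) ^ 2 * ((h pq.1 pq.2 : ℚ) - (bigradedDim F G pq.1 pq.2 : ℚ))

/-- A finite decreasing filtration. -/
structure IsFiniteDecreasing (F : ℤ → Submodule ℂ A) : Prop where
  antitone : Antitone F
  exists_top : ∃ p, F p = ⊤
  exists_bot : ∃ p, F p = ⊥

variable (A) in
/-- The topology on the set of all subspaces of a finite dimensional complex space, as the disjoint
union of the Grassmannians `Gr(k, A)`; each of these has the quotient topology from the space of
linearly independent `k`-tuples (with the usual topology of a finite dimensional space). -/
@[reducible]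
def grassmannTopology : TopologicalSpace (Submodule ℂ A) :=
  letI : TopologicalSpace A := moduleTopology ℂ A
  ⨆ k : ℕ, TopologicalSpace.coinduced
    (fun v : {v : Fin k → A // LinearIndependent ℂ v} => Submodule.span ℂ (Set.range v.1))
    inferInstance

end Filtrations

/-! ### Real structures, Hodge structures, mixed Hodge structures -/

section Hodge

variable {V : Type*} [AddCommGroup V] [Module ℝ V]

variable (V) in
/-- Complex conjugation on `ℂ ⊗ V`. -/
def conj : (ℂ ⊗[ℝ] V) →ₛₗ[starRingEnd ℂ] (ℂ ⊗[ℝ] V) where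
  toFun := LinearMap.rTensor V Complex.conjAe.toLinearMap
  map_add' := map_add _
  map_smul' c x := by
    induction x using TensorProduct.induction_on with
    | zero => simp
    | tmul a v => simp [TensorProduct.smul_tmul']
    | add x y hx hy => rw [smul_add, map_add, hx, hy, map_add, smul_add]

/-- The conjugate filtration. -/
def conjFil (F : ℤ → Submodule ℂ (ℂ ⊗[ℝ] V)) (p : ℤ) : Submodule ℂ (ℂ ⊗[ℝ] V) :=
  (F p).map (conj V)

/-- `F` is the Hodge filtration of a real pure Hodge structure of weight `k` on `V`, polarized
by `Q`. (The twist in a form with values in `ℝ(-k)` is removed by the factor `(2πi)^k`.) -/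
structure IsPolarizedHodge (k : ℤ) (F : ℤ → Submodule ℂ (ℂ ⊗[ℝ] V))
    (Q : LinearMap.BilinForm ℝ V) : Prop where
  finite : IsFiniteDecreasing F
  opposed : ∀ p, IsCompl (F p) (conjFil F (k + 1 - p))
  symm : ∀ u v, Q u v = (-1 : ℝ) ^ k * Q v u
  riemann₁ : ∀ p, ∀ u ∈ F p, ∀ v ∈ F (k + 1 - p), Q.baseChange ℂ u v = 0
  riemann₂ : ∀ p q, p + q = k → ∀ u ∈ F p ⊓ conjFil F q, u ≠ 0 →
    0 < (Complex.I ^ (p - q) * Q.baseChange ℂ u (conj V u)).re ∧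
      (Complex.I ^ (p - q) * Q.baseChange ℂ u (conj V u)).im = 0

/-- `Gr^W_k = W_k / W_{k-1}`. -/
abbrev GrW (W : ℤ → Submodule ℝ V) (k : ℤ) : Type _ :=
  W k ⧸ (W (k - 1)).submoduleOf (W k)

/-- The filtration induced by `F` on `ℂ ⊗ Gr^W_k`: the image of `F^p ∩ (ℂ ⊗ W_k)`. -/
def inducedGrW (W : ℤ → Submodule ℝ V) (F : ℤ → Submodule ℂ (ℂ ⊗[ℝ] V)) (k p : ℤ) :
    Submodule ℂ (ℂ ⊗[ℝ] GrW W k) :=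
  ((F p).comap ((W k).subtype.baseChange ℂ)).map
    (((W (k - 1)).submoduleOf (W k)).mkQ.baseChange ℂ)

/-- The Hodge number `h^{p,q} = dim Gr_F^p Gr^W_{p+q}`. -/
def hodgeNumber (W : ℤ → Submodule ℝ V) (F : ℤ → Submodule ℂ (ℂ ⊗[ℝ] V)) (p q : ℤ) : ℕ :=
  Module.finrank ℂ (Gr (inducedGrW W F (p + q)) p)

/-- The level of `ℝ`-splitting
`α = (1/2) ∑ (p+q)² (h^{p,q} - s^{p,q})`, with `s^{p,q} = dim Gr_F^p Gr_{F̄}^q`. -/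
def splitLevel (W : ℤ → Submodule ℝ V) (F : ℤ → Submodule ℂ (ℂ ⊗[ℝ] V)) : ℚ :=
  pairLevel (hodgeNumber W F) F (conjFil F)

/-- `(W, F)` is a real mixed Hodge structure on `V`, graded-polarized by the forms `Q k`. -/
structure IsGradedPolarizedMHS (W : ℤ → Submodule ℝ V)
    (Q : ∀ k, LinearMap.BilinForm ℝ (GrW W k)) (F : ℤ → Submodule ℂ (ℂ ⊗[ℝ] V)) : Prop where
  finite : IsFiniteDecreasing F
  graded : ∀ k, IsPolarizedHodge k (inducedGrW W F k) (Q k)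

/-- The classifying space of the Hodge filtrations on `ℂ ⊗ V` which, together with the fixed
weight filtration `W`, are mixed Hodge structures graded-polarized by the fixed forms `Q k` and
have the prescribed Hodge numbers `h`. -/
def ClassifyingSpace (W : ℤ → Submodule ℝ V) (Q : ∀ k, LinearMap.BilinForm ℝ (GrW W k))
    (h : ℤ → ℤ → ℕ) : Type _ :=
  {F : ℤ → Submodule ℂ (ℂ ⊗[ℝ] V) //
    IsGradedPolarizedMHS W Q F ∧ ∀ p q, hodgeNumber W F p q = h p q}

/-- The topology as a subspace of the variety of flags, inside the product of Grassmannians. -/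
instance (W : ℤ → Submodule ℝ V) (Q : ∀ k, LinearMap.BilinForm ℝ (GrW W k)) (h : ℤ → ℤ → ℕ) :
    TopologicalSpace (ClassifyingSpace W Q h) :=
  TopologicalSpace.induced Subtype.val
    (@Pi.topologicalSpace ℤ (fun _ => Submodule ℂ (ℂ ⊗[ℝ] V)) fun _ => grassmannTopology _)

end Hodge

/-! ### Local systems -/

/-- A local system of finite dimensional real vector spaces. For `y` near `x` the map
`transport x y` is the value at `y` of a flat trivialization, near `x`, with model `Fiber x`
(for `y` far from `x` it carries no information); the transition maps between the
trivializations are locally constant. -/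
structure LocalSystem (S : Type u) [TopologicalSpace S] where
  Fiber : S → Type w
  [addCommGroup : ∀ x, AddCommGroup (Fiber x)]
  [module : ∀ x, Module ℝ (Fiber x)]
  [finite : ∀ x, FiniteDimensional ℝ (Fiber x)]
  transport : ∀ x y, Fiber x →ₗ[ℝ] Fiber y
  bijective : ∀ x, ∀ᶠ y in 𝓝 x, Function.Bijective (transport x y)
  cocycle : ∀ x, ∀ᶠ y in 𝓝 x, ∀ᶠ z in 𝓝 y,
    transport x z = transport y z ∘ₗ transport x y

attribute [instance] LocalSystem.addCommGroup LocalSystem.module LocalSystem.finite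

namespace LocalSystem

variable {S : Type u} [TopologicalSpace S] (L : LocalSystem.{u, w} S)

/-- A family of subspaces of the fibres that is a sub-local system. -/
def IsSubsystem (B : ∀ x, Submodule ℝ (L.Fiber x)) : Prop :=
  ∀ x, ∀ᶠ y in 𝓝 x, (B x).map (L.transport x y) = B y

/-- A family of bilinear forms on the fibres that is flat. -/
def IsFlatForm (Q : ∀ x, LinearMap.BilinForm ℝ (L.Fiber x)) : Prop :=
  ∀ x, ∀ᶠ y in 𝓝 x, ∀ u v, Q y (L.transport x y u) (L.transport x y v) = Q x u v

variable (W : ∀ x, ℤ → Submodule ℝ (L.Fiber x))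

open Classical in
/-- The map induced on `Gr^W_k` by the transport from `x` to `y`, wherever the latter respects the
filtration (which is so for `y` near `x`). -/
def grTransport (k : ℤ) (x y : S) : GrW (W x) k →ₗ[ℝ] GrW (W y) k :=
  if h : W x k ≤ (W y k).comap (L.transport x y) ∧
      W x (k - 1) ≤ (W y (k - 1)).comap (L.transport x y) then
    Submodule.mapQ _ _ ((L.transport x y).restrict h.1) (by
      intro u hu
      rw [Submodule.mem_comap]
      have hu' : u.1 ∈ W x (k - 1) := hu
      exact h.2 hu')
  else 0

/-- The local system `Gr^W_k` of a filtration `W` by sub-local systems. -/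
def gr (hW : ∀ k, L.IsSubsystem fun x => W x k) (k : ℤ) : LocalSystem.{u, w} S where
  Fiber x := GrW (W x) k
  transport := L.grTransport W k
  bijective x := by
    filter_upwards [L.bijective x, hW k x, hW (k - 1) x] with y hb h1 h2
    have h : W x k ≤ (W y k).comap (L.transport x y) ∧
        W x (k - 1) ≤ (W y (k - 1)).comap (L.transport x y) :=
      ⟨Submodule.map_le_iff_le_comap.1 h1.le, Submodule.map_le_iff_le_comap.1 h2.le⟩
    rw [grTransport, dif_pos h]
    constructor
    · rw [injective_iff_map_eq_zero]
      intro u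
      obtain ⟨u, rfl⟩ := Submodule.mkQ_surjective _ u
      intro hu
      rw [Submodule.mkQ_apply, Submodule.mapQ_apply, Submodule.Quotient.mk_eq_zero] at hu
      rw [Submodule.mkQ_apply, Submodule.Quotient.mk_eq_zero]
      have hu' : L.transport x y u.1 ∈ W y (k - 1) := hu
      rw [← h2] at hu'
      obtain ⟨u', hu', he⟩ := hu'
      have : u.1 = u' := hb.1 he.symm
      change u.1 ∈ W x (k - 1)
      rw [this]
      exact hu'
    · intro v
      obtain ⟨v, rfl⟩ := Submodule.mkQ_surjective _ v
      have hv : v.1 ∈ (W x k).map (L.transport x y) := h1.symm ▸ v.2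
      obtain ⟨u, hu, he⟩ := hv
      refine ⟨Submodule.Quotient.mk ⟨u, hu⟩, ?_⟩
      rw [Submodule.mapQ_apply, Submodule.mkQ_apply]
      congr 1
      exact Subtype.ext he
  cocycle x := by
    filter_upwards [L.cocycle x, hW k x, hW (k - 1) x] with y hc h1 h2
    filter_upwards [hc, hW k y, hW (k - 1) y] with z hz h3 h4
    have hxy : W x k ≤ (W y k).comap (L.transport x y) ∧
        W x (k - 1) ≤ (W y (k - 1)).comap (L.transport x y) :=
      ⟨Submodule.map_le_iff_le_comap.1 h1.le, Submodule.map_le_iff_le_comap.1 h2.le⟩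
    have hyz : W y k ≤ (W z k).comap (L.transport y z) ∧
        W y (k - 1) ≤ (W z (k - 1)).comap (L.transport y z) :=
      ⟨Submodule.map_le_iff_le_comap.1 h3.le, Submodule.map_le_iff_le_comap.1 h4.le⟩
    have hxz : W x k ≤ (W z k).comap (L.transport x z) ∧
        W x (k - 1) ≤ (W z (k - 1)).comap (L.transport x z) := by
      rw [hz]
      exact ⟨fun u hu => hyz.1 (hxy.1 hu), fun u hu => hyz.2 (hxy.2 hu)⟩
    rw [grTransport, grTransport, grTransport, dif_pos hxy, dif_pos hyz, dif_pos hxz]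
    ext u
    simp [hz, LinearMap.restrict_apply]

end LocalSystem

/-! ### Variations -/

section Variations

variable (E : Type v) [NormedAddCommGroup E] [NormedSpace ℂ E]
variable {S : Type u} [TopologicalSpace S] [ChartedSpace E S]

/-- A function to a finite dimensional complex vector space that is holomorphic near `x`. -/
def IsHolomorphicNear {A : Type*} [AddCommGroup A] [Module ℂ A] (σ : S → A) (x : S) : Prop :=
  ∀ᶠ y in 𝓝 x, ∀ φ : Module.Dual ℂ A, MDifferentiableAt 𝓘(ℂ, E) 𝓘(ℂ, ℂ) (fun z => φ (σ z)) y

/-- A family of subspaces of the spaces `ℂ ⊗ L_x` that is a holomorphic subbundle of `𝒪 ⊗ L`: near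
each `x`, in the flat trivialization at `x`, it is spanned by a holomorphic frame. -/
def IsHolomorphicSubbundle (L : LocalSystem.{u, w} S)
    (B : ∀ x, Submodule ℂ (ℂ ⊗[ℝ] L.Fiber x)) : Prop :=
  ∀ x, ∃ (m : ℕ) (e : Fin m → S → ℂ ⊗[ℝ] L.Fiber x), (∀ i, IsHolomorphicNear E (e i) x) ∧
    ∀ᶠ y in 𝓝 x, LinearIndependent ℂ (fun i => e i y) ∧
      B y = (Submodule.span ℂ (Set.range fun i => e i y)).map ((L.transport x y).baseChange ℂ)

/-- Griffiths transversality `∇ F^p ⊆ Ω¹ ⊗ F^{p-1}` for the flat connection of `𝒪 ⊗ L`. For every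
local holomorphic section `σ` of `F^p` near `x`, written in the flat trivialization at `x`, all
derivatives of `σ` at `x` lie in `F^{p-1}`; the latter is tested by linear forms. -/
def IsTransversal (L : LocalSystem.{u, w} S)
    (F : ∀ x, ℤ → Submodule ℂ (ℂ ⊗[ℝ] L.Fiber x)) : Prop :=
  ∀ x p (σ : S → ℂ ⊗[ℝ] L.Fiber x), IsHolomorphicNear E σ x →
    (∀ᶠ y in 𝓝 x, (L.transport x y).baseChange ℂ (σ y) ∈ F y p) →
    ∀ φ : Module.Dual ℂ (ℂ ⊗[ℝ] L.Fiber x), (∀ u ∈ F x (p - 1), φ u = 0) →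
      mfderiv 𝓘(ℂ, E) 𝓘(ℂ, ℂ) (fun y => φ (σ y)) x = 0

/-- `(L, F, Q)` is a polarized variation of Hodge structures of weight `k`. -/
structure IsPolarizedVHS (L : LocalSystem.{u, w} S) (k : ℤ)
    (F : ∀ x, ℤ → Submodule ℂ (ℂ ⊗[ℝ] L.Fiber x))
    (Q : ∀ x, LinearMap.BilinForm ℝ (L.Fiber x)) : Prop where
  subbundle : ∀ p, IsHolomorphicSubbundle E L fun x => F x p
  flat : L.IsFlatForm Q
  transversal : IsTransversal E L F
  hodge : ∀ x, IsPolarizedHodge k (F x) (Q x)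

variable (S) in
/-- A graded-polarized variation of (real) mixed Hodge structures over `S`. -/
structure GradedPolarizedVMHS where
  L : LocalSystem.{u, w} S
  W : ∀ x, ℤ → Submodule ℝ (L.Fiber x)
  W_monotone : ∀ x, Monotone (W x)
  W_exists_top : ∀ x, ∃ k, W x k = ⊤
  W_exists_bot : ∀ x, ∃ k, W x k = ⊥
  W_subsystem : ∀ k, L.IsSubsystem fun x => W x k
  F : ∀ x, ℤ → Submodule ℂ (ℂ ⊗[ℝ] L.Fiber x)
  F_finite : ∀ x, IsFiniteDecreasing (F x)
  F_subbundle : ∀ p, IsHolomorphicSubbundle E L fun x => F x p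
  F_transversal : IsTransversal E L F
  Q : ∀ k x, LinearMap.BilinForm ℝ (GrW (W x) k)
  graded : ∀ k, IsPolarizedVHS E (L.gr W W_subsystem k) k
    (fun x => inducedGrW (W x) (F x) k) (Q k)

namespace GradedPolarizedVMHS

variable {E} (𝒱 : GradedPolarizedVMHS.{u, v, w} E S)

/-- The level of `ℝ`-splitting of the mixed Hodge structure at the point `x`. -/
def alpha (x : S) : ℚ := splitLevel (𝒱.W x) (𝒱.F x)

/-- The classifying space attached to the variation and the base point `s`. -/
abbrev Classifying (s : S) : Type w :=
  ClassifyingSpace (𝒱.W s) (fun k => 𝒱.Q k s) (hodgeNumber (𝒱.W s) (𝒱.F s))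

/-- The level of `ℝ`-splitting on the classifying space. -/
def alphaM (s : S) (z : 𝒱.Classifying s) : ℚ := splitLevel (𝒱.W s) z.1

/-- The invariant `α` on the product of the classifying space with itself, in which the Hodge
filtration and its conjugate are replaced by two independent points. -/
def alphaMM (s : S) (z : 𝒱.Classifying s × 𝒱.Classifying s) : ℚ :=
  pairLevel (hodgeNumber (𝒱.W s) (𝒱.F s)) z.1.1 z.2.1

/-- `Φ` is the lifted period map on a covering `π : T → S` with base point `t₀`: there is a
flat trivialization `τ` of the pulled back local system, with model the fibre at `π t₀` and equal
to the identity at `t₀`, that carries the Hodge filtration at each `t` to `Φ t`. -/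
def IsPeriodMap {T : Type*} [TopologicalSpace T] (π : T → S) (t₀ : T)
    (Φ : T → 𝒱.Classifying (π t₀)) : Prop :=
  ∃ τ : ∀ t, 𝒱.L.Fiber (π t) ≃ₗ[ℝ] 𝒱.L.Fiber (π t₀),
    τ t₀ = LinearEquiv.refl ℝ _ ∧
    (∀ t, ∀ᶠ t' in 𝓝 t, (τ t').toLinearMap ∘ₗ 𝒱.L.transport (π t) (π t') = (τ t).toLinearMap) ∧
    (∀ t k, (𝒱.W (π t) k).map (τ t).toLinearMap = 𝒱.W (π t₀) k) ∧
    ∀ t p, (Φ t).1 p = (𝒱.F (π t) p).map ((τ t).toLinearMap.baseChange ℂ)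

end GradedPolarizedVMHS

end Variations

/-! ### Stratifications -/

/-- The level sets `{a = n}`, `n ∈ ℤ`, of `a` form a finite stratification of `X`: `X` is their
disjoint union, they are locally closed, only finitely many are nonempty, and the closure of
each lies in the union of the strata of at most the same level. -/
structure IsStratifiedByLevel {X : Type*} [TopologicalSpace X] (a : X → ℚ) : Prop where
  iUnion_eq : ⋃ n : ℤ, {x | a x = n} = Set.univ
  disjoint : Pairwise fun m n : ℤ => Disjoint {x | a x = m} {x | a x = n}
  locallyClosed : ∀ n : ℤ, IsLocallyClosed {x | a x = n}
  finite : {n : ℤ | {x | a x = n}.Nonempty}.Finite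
  closure_subset : ∀ n : ℤ, closure {x | a x = n} ⊆ ⋃ m ≤ n, {x | a x = m}

/-- `a` is integer-valued and lower semicontinuous, and stratifies `X`. -/
structure IsSemicontinuousLevel {X : Type*} [TopologicalSpace X] (a : X → ℚ) : Prop where
  integer : ∀ x, ∃ n : ℤ, a x = n
  lowerSemicontinuous : LowerSemicontinuous a
  stratified : IsStratifiedByLevel a

end SplitLevel

end

namespace SplitLevel

universe u v w

/-! ### Dimensions of graded pieces -/

section Dimensions

variable {A B : Type*} [AddCommGroup A] [Module ℂ A] [AddCommGroup B] [Module ℂ B]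

/-! The level is a constant minus a sum of dimensions of intersections. The numbers `s p q = dim
Gr_F^p Gr_G^q` are mixed second differences of `dim (F^p ∩ G^q)`. They have the same row and column
sums as `h`, namely the jumps of `dim F^p` and `dim G^q`. In `(p + q)²` the terms depending on `p`
or `q` alone therefore cancel, and half the sum is that of `(p + N)(q + N)(h - s)`. Two Abel
summations turn the `s` part into a sum of `dim (F^{p+1} ∩ G^{q+1})` over a finite box
(`HasMarginals.pairLevel_eq`). These dimensions are bounded integers, upper semicontinuous on
Grassmannians (`eventually_finrank_inf_le`), so the level is integral, bounded and lower
semicontinuous. The stratification is formal from there.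

For points of the classifying space the row sums come from telescoping along the weight, and the
column sums follow by the Hodge symmetry `h^{p,q} = h^{q,p}`, which comes from opposedness.
Conjugation preserves dimensions and is continuous on Grassmannians, so the pair `(F, F̄)` is
covered as well.

For the period map, the frames of the local system form a covering of `S`. Lifting `π` to it from
the simply connected space gives a flat trivialization. In it `W` and `Q` are constant because they
are flat, and `F` is continuous because it has continuous local frames. A real filtered isomorphism
preserves `α`, so `α` is pulled back from the classifying space. -/

theorem finrank_map_add_finrank_inf_ker [FiniteDimensional ℂ A] (f : A →ₗ[ℂ] B)
    (U : Submodule ℂ A) :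
    Module.finrank ℂ (U.map f) + Module.finrank ℂ (U ⊓ LinearMap.ker f : Submodule ℂ A) =
      Module.finrank ℂ U := by
  have h := LinearMap.finrank_range_add_finrank_ker (f.domRestrict U)
  rw [LinearMap.range_domRestrict, LinearMap.ker_domRestrict] at h
  rw [← h, ← Submodule.finrank_map_subtype_eq U, Submodule.map_comap_subtype]

theorem finrank_submoduleOf (U W : Submodule ℂ A) :
    Module.finrank ℂ (U.submoduleOf W) = Module.finrank ℂ (U ⊓ W : Submodule ℂ A) := by
  rw [← Submodule.finrank_map_subtype_eq W, Submodule.submoduleOf, Submodule.map_comap_subtype,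
    inf_comm]

theorem finrank_gr [FiniteDimensional ℂ A] {F : ℤ → Submodule ℂ A} (hF : Antitone F)
    (p : ℤ) :
    (Module.finrank ℂ (Gr F p) : ℤ) =
      (Module.finrank ℂ (F p) : ℤ) - Module.finrank ℂ (F (p + 1)) := by
  have h := Submodule.finrank_quotient_add_finrank ((F (p + 1)).submoduleOf (F p))
  rw [finrank_submoduleOf, inf_eq_left.2 (hF (by lia))] at h
  rw [← h]
  push_cast
  ring

theorem finrank_inducedGr [FiniteDimensional ℂ A] (F : ℤ → Submodule ℂ A)
    {G : ℤ → Submodule ℂ A} (hG : Antitone G)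
    (q p : ℤ) : (Module.finrank ℂ (inducedGr F G q p) : ℤ) =
      (Module.finrank ℂ (F p ⊓ G q : Submodule ℂ A) : ℤ) -
        Module.finrank ℂ (F p ⊓ G (q + 1) : Submodule ℂ A) := by
  have h := finrank_map_add_finrank_inf_ker ((G (q + 1)).submoduleOf (G q)).mkQ
    ((F p).submoduleOf (G q))
  have e : (F p).submoduleOf (G q) ⊓ (G (q + 1)).submoduleOf (G q) =
      (F p ⊓ G (q + 1)).submoduleOf (G q) := rfl
  rw [Submodule.ker_mkQ, e, finrank_submoduleOf, finrank_submoduleOf, inf_assoc,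
    inf_eq_left.2 (hG (show q ≤ q + 1 by lia))] at h
  rw [inducedGr, ← h]
  push_cast
  ring

theorem inducedGr_antitone {F : ℤ → Submodule ℂ A} (hF : Antitone F) (G : ℤ → Submodule ℂ A)
    (q : ℤ) : Antitone (inducedGr F G q) := fun _ _ h =>
  Submodule.map_mono (Submodule.comap_mono (hF h))

/-- `dim (F^p ∩ G^q)`, as an integer. -/
noncomputable def infDim (F G : ℤ → Submodule ℂ A) (p q : ℤ) : ℤ :=
  Module.finrank ℂ (F p ⊓ G q : Submodule ℂ A)

/-- The image of `F^p ∩ G^q` in `Gr_G^q` has kernel `F^p ∩ G^{q+1}`. The resulting mixed second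
difference is symmetric in the two filtrations, so it can be summed by parts in either index. -/
theorem bigradedDim_eq [FiniteDimensional ℂ A] {F G : ℤ → Submodule ℂ A}
    (hF : Antitone F) (hG : Antitone G) (p q : ℤ) :
    (bigradedDim F G p q : ℤ) = (infDim F G p q - infDim F G p (q + 1)) -
      (infDim F G (p + 1) q - infDim F G (p + 1) (q + 1)) := by
  rw [bigradedDim, finrank_gr (inducedGr_antitone hF G q), finrank_inducedGr F hG,
    finrank_inducedGr F hG]
  rfl

end Dimensions

/-! ### Summation over a box of integers -/

section Summation

theorem sum_Ico_sub_add_one (f : ℤ → ℤ) {a b : ℤ} (hab : a ≤ b) :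
    ∑ p ∈ Finset.Ico a b, (f p - f (p + 1)) = f a - f b := by
  induction b, hab using Int.leInduction with
  | base => simp
  | succ b hab ih =>
    rw [← Finset.insert_Ico_right_eq_Ico_add_one hab, Finset.sum_insert (by simp), ih]
    ring

/-- Summation by parts; the weight `p - a` vanishes at the left end, so only the right end leaves a
boundary term. -/
theorem sum_Ico_mul_sub_add_one (f : ℤ → ℤ) {a b : ℤ} (hab : a ≤ b) :
    ∑ p ∈ Finset.Ico a b, (p - a) * (f p - f (p + 1)) =
      ∑ p ∈ Finset.Ico a b, f (p + 1) - (b - a) * f b := by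
  induction b, hab using Int.leInduction with
  | base => simp
  | succ b hab ih =>
    rw [← Finset.insert_Ico_right_eq_Ico_add_one hab, Finset.sum_insert (by simp), ih,
      Finset.sum_insert (by simp)]
    ring

theorem finsum_sub_sub_one (f : ℤ → ℤ) {a b c : ℤ} (hab : a ≤ b) (ha : ∀ k < a, f k = 0)
    (hb : ∀ k, b ≤ k → f k = c) : ∑ᶠ k, (f k - f (k - 1)) = c := by
  -- The index `b` must be included, since `f (b - 1)` may differ from `c`.
  rw [finsum_eq_sum_of_support_subset (s := Finset.Ico a (b + 1))]
  · have h := sum_Ico_sub_add_one (fun k => - f (k - 1)) (show a ≤ b + 1 by lia)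
    simp only [add_sub_cancel_right, neg_sub_neg] at h
    rw [h, ha (a - 1) (by lia), hb _ le_rfl, sub_zero]
  · intro k hk
    by_contra hk'
    rw [Finset.coe_Ico, Set.mem_Ico, not_and_or, not_le, not_lt] at hk'
    apply hk
    rcases hk' with h | h
    · simp [ha _ h, ha (k - 1) (by lia)]
    · simp [hb k (by lia), hb (k - 1) (by lia)]

end Summation

/-! ### The level of a pair of filtrations -/

section Level

variable {A : Type*} [AddCommGroup A] [Module ℂ A] [FiniteDimensional ℂ A]

/-- The function `h` of finite support has the dimensions of the graded pieces of `F` and of `G`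
as its marginals. -/
structure HasMarginals (h : ℤ → ℤ → ℕ) (F G : ℤ → Submodule ℂ A) : Prop where
  finite_left : IsFiniteDecreasing F
  finite_right : IsFiniteDecreasing G
  row : ∀ p, ∑ᶠ q, (h p q : ℤ) = (Module.finrank ℂ (F p) : ℤ) - Module.finrank ℂ (F (p + 1))
  col : ∀ q, ∑ᶠ p, (h p q : ℤ) = (Module.finrank ℂ (G q) : ℤ) - Module.finrank ℂ (G (q + 1))

/-- Nested subspaces of equal dimension coincide, so from `N` on the filtration is constant, and it
eventually vanishes. -/
theorem IsFiniteDecreasing.eq_bot_of_finrank_eq {F : ℤ → Submodule ℂ A} (hF : IsFiniteDecreasing F)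
    {N : ℤ} (h : ∀ p, N ≤ p → Module.finrank ℂ (F p) = Module.finrank ℂ (F (p + 1))) :
    ∀ p, N ≤ p → F p = ⊥ := by
  have key : ∀ p, N ≤ p → F p = F N := by
    intro p hp
    induction p, hp using Int.leInduction with
    | base => rfl
    | succ p hp ih =>
      rw [← ih]
      exact Submodule.eq_of_le_of_finrank_eq (hF.antitone (by lia)) (h p hp).symm
  obtain ⟨p₀, hp₀⟩ := hF.exists_bot
  intro p hp
  rw [key p hp, ← key (max N p₀) (le_max_left _ _), eq_bot_iff, ← hp₀]
  exact hF.antitone (le_max_right _ _)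

theorem IsFiniteDecreasing.eq_top_of_finrank_eq {F : ℤ → Submodule ℂ A} (hF : IsFiniteDecreasing F)
    {N : ℤ} (h : ∀ p, p < N → Module.finrank ℂ (F p) = Module.finrank ℂ (F (p + 1))) :
    ∀ p, p ≤ N → F p = ⊤ := by
  have key : ∀ p, p ≤ N → F p = F N := by
    intro p hp
    induction p, hp using Int.leInductionDown with
    | base => rfl
    | pred p hp ih =>
      rw [← ih]
      have := h (p - 1) (by lia)
      rw [sub_add_cancel] at this
      exact (Submodule.eq_of_le_of_finrank_eq (hF.antitone (by lia)) this.symm).symm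
  obtain ⟨p₀, hp₀⟩ := hF.exists_top
  intro p hp
  rw [key p hp, ← key (min N p₀) (min_le_left _ _), eq_top_iff, ← hp₀]
  exact hF.antitone (min_le_right _ _)

/-- The function `h` vanishes outside of the box `[-N, N)²`. -/
def SupportedInBox (h : ℤ → ℤ → ℕ) (N : ℤ) : Prop :=
  ∀ p q, h p q ≠ 0 → p ∈ Finset.Ico (-N) N ∧ q ∈ Finset.Ico (-N) N

/-- The level of a pair of filtrations whose graded pieces have the marginals of `h` as their
dimensions is a constant minus a sum of dimensions of intersections. -/
theorem HasMarginals.pairLevel_eq {h : ℤ → ℤ → ℕ} {F G : ℤ → Submodule ℂ A}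
    (H : HasMarginals h F G) {N : ℤ} (hN : 0 ≤ N) (hh : SupportedInBox h N) :
    pairLevel h F G = ((∑ p ∈ Finset.Ico (-N) N, ∑ q ∈ Finset.Ico (-N) N,
      ((p + N) * (q + N) * h p q - infDim F G (p + 1) (q + 1)) : ℤ) : ℚ) := by
  have hrow : ∀ p, ∑ᶠ q, (h p q : ℤ) = ∑ q ∈ Finset.Ico (-N) N, (h p q : ℤ) := fun p =>
    finsum_eq_sum_of_support_subset _ fun q hq => (hh p q (by simpa using hq)).2
  have hcol : ∀ q, ∑ᶠ p, (h p q : ℤ) = ∑ p ∈ Finset.Ico (-N) N, (h p q : ℤ) := fun q =>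
    finsum_eq_sum_of_support_subset _ fun p hp => (hh p q (by simpa using hp)).1
  -- Outside the box the marginals of `h` vanish, so neither filtration jumps there. This fixes the
  -- boundary values of `infDim` on all four sides of the box.
  have hrow0 : ∀ p, p ∉ Finset.Ico (-N) N →
      Module.finrank ℂ (F p) = Module.finrank ℂ (F (p + 1)) := by
    intro p hp
    have h1 := H.row p
    have h2 : ∀ q, (h p q : ℤ) = 0 := fun q => by
      by_contra hq
      exact hp (hh p q (by simpa using hq)).1
    simp only [h2, finsum_zero] at h1
    lia
  have hcol0 : ∀ q, q ∉ Finset.Ico (-N) N →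
      Module.finrank ℂ (G q) = Module.finrank ℂ (G (q + 1)) := by
    intro q hq
    have h1 := H.col q
    have h2 : ∀ p, (h p q : ℤ) = 0 := fun p => by
      by_contra hp
      exact hq (hh p q (by simpa using hp)).2
    simp only [h2, finsum_zero] at h1
    lia
  have Fbot := H.finite_left.eq_bot_of_finrank_eq (N := N) fun p hp => hrow0 p (by simp [hp])
  have Ftop := H.finite_left.eq_top_of_finrank_eq (N := -N)
    fun p hp => hrow0 p (by rw [Finset.mem_Ico]; lia)
  have Gbot := H.finite_right.eq_bot_of_finrank_eq (N := N) fun p hp => hcol0 p (by simp [hp])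
  have Gtop := H.finite_right.eq_top_of_finrank_eq (N := -N)
    fun p hp => hcol0 p (by rw [Finset.mem_Ico]; lia)
  have dF0 : ∀ p q, N ≤ p → infDim F G p q = 0 := fun p q hp => by simp [infDim, Fbot p hp]
  have dG0 : ∀ p q, N ≤ q → infDim F G p q = 0 := fun p q hq => by simp [infDim, Gbot q hq]
  have dF1 : ∀ p q, p ≤ -N → infDim F G p q = Module.finrank ℂ (G q) := fun p q hp => by
    rw [infDim, Ftop p hp, top_inf_eq]
  have dG1 : ∀ p q, q ≤ -N → infDim F G p q = Module.finrank ℂ (F p) := fun p q hq => by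
    rw [infDim, Gtop q hq, inf_top_eq]
  set s : ℤ → ℤ → ℤ := fun p q => (bigradedDim F G p q : ℤ) with hs
  have s_eq : ∀ p q, s p q = (infDim F G p q - infDim F G p (q + 1)) -
      (infDim F G (p + 1) q - infDim F G (p + 1) (q + 1)) := fun p q =>
    bigradedDim_eq H.finite_left.antitone H.finite_right.antitone p q
  have hNN : -N ≤ N := by lia
  have s_row : ∀ p, ∑ q ∈ Finset.Ico (-N) N, s p q = ∑ q ∈ Finset.Ico (-N) N, (h p q : ℤ) := by
    intro p
    have h1 := sum_Ico_sub_add_one (fun q => infDim F G p q - infDim F G (p + 1) q) hNN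
    rw [← hrow, H.row, Finset.sum_congr rfl fun q _ => ?_, h1]
    · rw [dG1 _ _ le_rfl, dG1 _ _ le_rfl, dG0 _ _ le_rfl, dG0 _ _ le_rfl]
      ring
    · rw [s_eq]
      ring
  have s_col : ∀ q, ∑ p ∈ Finset.Ico (-N) N, s p q = ∑ p ∈ Finset.Ico (-N) N, (h p q : ℤ) := by
    intro q
    have h1 := sum_Ico_sub_add_one (fun p => infDim F G p q - infDim F G p (q + 1)) hNN
    rw [← hcol, H.col, Finset.sum_congr rfl fun p _ => s_eq p q, h1,
      dF1 _ _ le_rfl, dF1 _ _ le_rfl, dF0 _ _ le_rfl, dF0 _ _ le_rfl]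
    ring
  have s_supp : ∀ p q, s p q ≠ 0 → p ∈ Finset.Ico (-N) N ∧ q ∈ Finset.Ico (-N) N := by
    intro p q hpq
    rw [s_eq] at hpq
    simp only [Finset.mem_Ico]
    by_contra hc
    apply hpq
    by_cases h1 : N ≤ p
    · rw [dF0 p q h1, dF0 p _ h1, dF0 (p + 1) q (by lia), dF0 (p + 1) _ (by lia)]
      ring
    by_cases h2 : p < -N
    · rw [dF1 p q (by lia), dF1 p _ (by lia), dF1 (p + 1) q (by lia), dF1 (p + 1) _ (by lia)]
      ring
    by_cases h3 : N ≤ q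
    · rw [dG0 p q h3, dG0 p _ (by lia), dG0 (p + 1) q h3, dG0 (p + 1) _ (by lia)]
      ring
    · rw [dG1 p q (by lia), dG1 p _ (by lia), dG1 (p + 1) q (by lia), dG1 (p + 1) _ (by lia)]
      ring
  -- Abel summation in `q`, then in `p`: the weights vanish on the lower edges of the box and the
  -- dimensions on the upper edges, so no boundary term survives.
  have s_sum : ∑ p ∈ Finset.Ico (-N) N, ∑ q ∈ Finset.Ico (-N) N, (p + N) * (q + N) * s p q =
      ∑ p ∈ Finset.Ico (-N) N, ∑ q ∈ Finset.Ico (-N) N, infDim F G (p + 1) (q + 1) := by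
    have h1 : ∀ p, ∑ q ∈ Finset.Ico (-N) N, (q + N) * (infDim F G p q - infDim F G p (q + 1)) =
        ∑ q ∈ Finset.Ico (-N) N, infDim F G p (q + 1) := fun p => by
      have h2 := sum_Ico_mul_sub_add_one (fun q => infDim F G p q) hNN
      simp only [sub_neg_eq_add] at h2
      rw [h2, dG0 _ _ le_rfl]
      ring
    have h3 := sum_Ico_mul_sub_add_one
      (fun p => ∑ q ∈ Finset.Ico (-N) N, infDim F G p (q + 1)) hNN
    simp only [sub_neg_eq_add] at h3
    rw [Finset.sum_eq_zero (fun q _ => dF0 N (q + 1) le_rfl), mul_zero, sub_zero] at h3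
    rw [← h3]
    refine Finset.sum_congr rfl fun p _ => ?_
    rw [← h1 p, ← h1 (p + 1), ← Finset.sum_sub_distrib, Finset.mul_sum]
    refine Finset.sum_congr rfl fun q _ => ?_
    rw [s_eq]
    ring
  have total : ∑ p ∈ Finset.Ico (-N) N, ∑ q ∈ Finset.Ico (-N) N, (p + q) ^ 2 * ((h p q : ℤ) - s p q)
      = 2 * ∑ p ∈ Finset.Ico (-N) N, ∑ q ∈ Finset.Ico (-N) N,
        ((p + N) * (q + N) * h p q - infDim F G (p + 1) (q + 1)) := by
    -- The splitting used is `(p + q)² = 2(p + N)(q + N) + (p² - 2Np - 2N²) + (q² - 2Nq)`; the last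
    -- two terms are killed by the equality of row sums and of column sums.
    have e1 : ∑ p ∈ Finset.Ico (-N) N, ∑ q ∈ Finset.Ico (-N) N,
        (p ^ 2 - 2 * N * p - 2 * N ^ 2) * ((h p q : ℤ) - s p q) = 0 := by
      refine Finset.sum_eq_zero fun p _ => ?_
      rw [← Finset.mul_sum, Finset.sum_sub_distrib, s_row, sub_self, mul_zero]
    have e2 : ∑ p ∈ Finset.Ico (-N) N, ∑ q ∈ Finset.Ico (-N) N,
        (q ^ 2 - 2 * N * q) * ((h p q : ℤ) - s p q) = 0 := by
      rw [Finset.sum_comm]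
      refine Finset.sum_eq_zero fun q _ => ?_
      rw [← Finset.mul_sum, Finset.sum_sub_distrib, s_col, sub_self, mul_zero]
    simp only [Finset.sum_sub_distrib (f := fun q => (_ + N) * (q + N) * (h _ q : ℤ))]
    rw [Finset.sum_sub_distrib, ← s_sum, ← Finset.sum_sub_distrib]
    simp only [← Finset.sum_sub_distrib, Finset.mul_sum]
    rw [← sub_eq_zero, ← Finset.sum_sub_distrib, ← add_zero (0 : ℤ)]
    nth_rw 1 [← e1]
    rw [← e2]
    simp only [← Finset.sum_sub_distrib, ← Finset.sum_add_distrib]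
    refine Finset.sum_congr rfl fun p _ => Finset.sum_congr rfl fun q _ => ?_
    ring
  rw [pairLevel, finsum_eq_sum_of_support_subset (s := Finset.Ico (-N) N ×ˢ Finset.Ico (-N) N),
    Finset.sum_product]
  · have := congrArg (Int.cast : ℤ → ℚ) total
    push_cast at this ⊢
    simp only [hs, Int.cast_natCast] at this
    rw [this]
    ring
  · rintro ⟨p, q⟩ hpq
    by_contra hc
    apply hpq
    have h1 : h p q = 0 := by
      by_contra h1
      exact hc (by simpa using hh p q h1)
    have h2 : bigradedDim F G p q = 0 := by
      by_contra h2
      exact hc (by simpa using s_supp p q (by simpa [hs] using h2))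
    simp [h1, h2]

end Level

/-! ### The topology of the Grassmannians -/

section Grassmann

theorem exists_fin_frame {A : Type*} [AddCommGroup A] [Module ℂ A] [FiniteDimensional ℂ A]
    (U : Submodule ℂ A) : ∃ v : Fin (Module.finrank ℂ U) → A,
    LinearIndependent ℂ v ∧ Submodule.span ℂ (Set.range v) = U := by
  let b := Module.finBasis ℂ U
  refine ⟨fun i => (b i : A), b.linearIndependent.map' U.subtype U.ker_subtype, ?_⟩
  have h := congrArg (Submodule.map U.subtype) b.span_eq
  rw [Submodule.map_span, ← Set.range_comp, Submodule.map_subtype_top] at h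
  exact h

variable {A : Type*} [AddCommGroup A] [Module ℂ A] [FiniteDimensional ℂ A]
  [TopologicalSpace A] [IsModuleTopology ℂ A]

theorem isOpen_linearIndependent (ι : Type*) [Finite ι] :
    IsOpen {v : ι → A | LinearIndependent ℂ v} := by
  let e := (Module.finBasis ℂ A).equivFun
  have he : Continuous e := IsModuleTopology.continuous_of_linearMap e.toLinearMap
  have h := isOpen_setOfPred_linearIndependent (𝕜 := ℂ)
    (E := Fin (Module.finrank ℂ A) → ℂ) (ι := ι)
  have h' := h.preimage (f := fun v : ι → A => fun i => e (v i)) (by fun_prop)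
  convert h' using 1
  ext v
  exact (e.toLinearMap.linearIndependent_iff (v := v) e.ker).symm

/-- Holomorphy of frames is tested on linear forms; since coordinates are linear forms, it yields
continuity of the frame itself. -/
theorem continuousAt_of_dual {X : Type*} [TopologicalSpace X] {σ : X → A} {x : X}
    (h : ∀ φ : Module.Dual ℂ A, ContinuousAt (fun y => φ (σ y)) x) : ContinuousAt σ x := by
  let e := (Module.finBasis ℂ A).equivFun
  have := IsModuleTopology.toContinuousAdd ℂ A
  have he : Continuous e.symm := IsModuleTopology.continuous_of_linearMap e.symm.toLinearMap
  have h1 : ContinuousAt (fun y => e (σ y)) x :=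
    continuousAt_pi.2 fun i => h (LinearMap.proj i ∘ₗ e.toLinearMap)
  simpa [Function.comp_def] using he.continuousAt.comp h1

/-- Independent tuples form an open subset of `A^k`, so openness in the quotient topology can be
tested in `A^k` itself. -/
theorem isOpen_grassmann_iff {O : Set (Submodule ℂ A)} :
    IsOpen[grassmannTopology A] O ↔ ∀ k : ℕ, IsOpen {v : Fin k → A |
      LinearIndependent ℂ v ∧ Submodule.span ℂ (Set.range v) ∈ O} := by
  rw [grassmannTopology, ← eq_moduleTopology ℂ A, isOpen_iSup_iff]
  refine forall_congr' fun k => ?_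
  rw [isOpen_coinduced, (isOpen_linearIndependent (A := A)
    (Fin k)).isOpenEmbedding_subtypeVal.isOpen_iff_image_isOpen]
  congr! 1
  ext v
  simp [and_comm]

/-- The spans of the tuples in an open set of linearly independent tuples form an open set. -/
theorem isOpen_grassmann_span {k : ℕ} {O : Set (Fin k → A)} (hO : IsOpen O) :
    IsOpen[grassmannTopology A]
      {U | ∃ v ∈ O, LinearIndependent ℂ v ∧ Submodule.span ℂ (Set.range v) = U} := by
  have := IsModuleTopology.toContinuousAdd ℂ A
  rw [isOpen_grassmann_iff]
  intro l
  rw [isOpen_iff_mem_nhds]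
  rintro w ⟨hw, v, hvO, hv, hvw⟩
  obtain rfl : k = l := by
    have h1 := finrank_span_eq_card hv
    have h2 := finrank_span_eq_card hw
    rw [hvw, h2] at h1
    simpa using h1.symm
  have hmem : ∀ i, v i ∈ Submodule.span ℂ (Set.range w) := fun i =>
    hvw ▸ Submodule.subset_span ⟨i, rfl⟩
  -- The coefficients of `v` in the basis `w` are kept fixed while `w` moves. The resulting tuple
  -- stays in `O`, stays independent, and spans the same space as the moved basis.
  choose g hg using fun i => (Submodule.mem_span_range_iff_exists_fun ℂ).1 (hmem i)
  let f : (Fin k → A) → (Fin k → A) := fun w' i => ∑ j, g i j • w' j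
  have hf : Continuous f := by fun_prop
  have hfw : f w = v := funext hg
  have h1 : ∀ᶠ w' in 𝓝 w, f w' ∈ O ∩ {v | LinearIndependent ℂ v} :=
    hf.continuousAt.eventually ((hO.inter (isOpen_linearIndependent _)).mem_nhds
      (by rw [hfw]; exact ⟨hvO, hv⟩))
  filter_upwards [h1, (isOpen_linearIndependent _).mem_nhds hw] with w' h1 h2
  refine ⟨h2, f w', h1.1, h1.2, Submodule.eq_of_le_of_finrank_eq ?_ ?_⟩
  · rw [Submodule.span_le]
    rintro _ ⟨i, rfl⟩
    exact Submodule.sum_mem _ fun j _ =>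
      Submodule.smul_mem _ _ (Submodule.subset_span ⟨j, rfl⟩)
  · rw [finrank_span_eq_card h1.2, finrank_span_eq_card h2]

/-- The span of a continuous frame is a continuous family of subspaces. -/
theorem tendsto_grassmann_span {X : Type*} {l : Filter X} {k : ℕ} {e : X → Fin k → A}
    {v : Fin k → A} (he : Filter.Tendsto e l (𝓝 v)) (hv : LinearIndependent ℂ v) :
    Filter.Tendsto (fun y => Submodule.span ℂ (Set.range (e y))) l
      (@nhds _ (grassmannTopology A) (Submodule.span ℂ (Set.range v))) := by
  let := grassmannTopology A
  rw [tendsto_nhds]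
  intro O hO hvO
  have h := he.eventually ((isOpen_grassmann_iff.1 hO k).mem_nhds ⟨hv, hvO⟩)
  filter_upwards [h] with y hy using hy.2

/-- The dimension of the intersection of two subspaces is upper semicontinuous. -/
theorem eventually_finrank_inf_le {X : Type*} {l : Filter X} {U V : X → Submodule ℂ A}
    {U₀ V₀ : Submodule ℂ A} (hU : Filter.Tendsto U l (@nhds _ (grassmannTopology A) U₀))
    (hV : Filter.Tendsto V l (@nhds _ (grassmannTopology A) V₀)) :
    ∀ᶠ y in l, Module.finrank ℂ (U y ⊓ V y : Submodule ℂ A) ≤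
      Module.finrank ℂ (U₀ ⊓ V₀ : Submodule ℂ A) := by
  let := grassmannTopology A
  obtain ⟨v, hv, hvU⟩ := exists_fin_frame U₀
  obtain ⟨w, hw, hwV⟩ := exists_fin_frame V₀
  -- A subfamily of the two bases that is a basis of `U₀ + V₀` stays independent nearby. So the
  -- dimension of the sum cannot drop while those of the summands stay fixed, and the dimension of
  -- the intersection cannot grow.
  obtain ⟨κ, a, ha, hspan, hli⟩ := exists_linearIndependent' ℂ (Sum.elim v w)
  have : Finite κ := Finite.of_injective a ha
  have := Fintype.ofFinite κ
  have hcard : Fintype.card κ = Module.finrank ℂ (U₀ ⊔ V₀ : Submodule ℂ A) := by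
    rw [← finrank_span_eq_card hli, hspan, Set.Sum.elim_range, Submodule.span_union, hvU, hwV]
  let J : (Fin (Module.finrank ℂ U₀) → A) × (Fin (Module.finrank ℂ V₀) → A) → κ → A :=
    fun vw i => Sum.elim vw.1 vw.2 (a i)
  have hJ : Continuous J := by
    refine continuous_pi fun i => ?_
    dsimp only [J]
    rcases a i with j | j
    · exact (continuous_apply j).comp continuous_fst
    · exact (continuous_apply j).comp continuous_snd
  have hopen := (isOpen_linearIndependent (A := A) κ).preimage hJ
  obtain ⟨O₁, O₂, hO₁, hO₂, hv₁, hw₂, hsub⟩ := isOpen_prod_iff.1 hopen v w hli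
  have e1 := hU.eventually ((isOpen_grassmann_span hO₁).mem_nhds ⟨v, hv₁, hv, hvU⟩)
  have e2 := hV.eventually ((isOpen_grassmann_span hO₂).mem_nhds ⟨w, hw₂, hw, hwV⟩)
  filter_upwards [e1, e2] with y ⟨v', hv'O, hv', hv'U⟩ ⟨w', hw'O, hw', hw'V⟩
  have hl : LinearIndependent ℂ (J (v', w')) := hsub ⟨hv'O, hw'O⟩
  have hle : Fintype.card κ ≤ Module.finrank ℂ (U y ⊔ V y : Submodule ℂ A) := by
    rw [← finrank_span_eq_card hl]
    refine Submodule.finrank_mono ?_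
    rw [Submodule.span_le, ← hv'U, ← hw'V, ← Submodule.span_union, ← Set.Sum.elim_range]
    rintro _ ⟨i, rfl⟩
    exact Submodule.subset_span ⟨a i, rfl⟩
  have h1 := Submodule.finrank_sup_add_finrank_inf_eq (U y) (V y)
  have h2 := Submodule.finrank_sup_add_finrank_inf_eq U₀ V₀
  have h3 : Module.finrank ℂ (U y) = Module.finrank ℂ U₀ := by
    rw [← hv'U, finrank_span_eq_card hv', Fintype.card_fin]
  have h4 : Module.finrank ℂ (V y) = Module.finrank ℂ V₀ := by
    rw [← hw'V, finrank_span_eq_card hw', Fintype.card_fin]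
  lia

end Grassmann

/-! ### Semicontinuous levels -/

section Semicontinuity

variable {X Y : Type*} [TopologicalSpace X] [TopologicalSpace Y]

/-- The sublevel sets of `b` are closed. A level set is the difference of two consecutive ones, and
its closure stays in the larger. -/
theorem isSemicontinuousLevel_of_bounded {a : X → ℚ} {b : X → ℤ} (hab : ∀ x, a x = b x)
    (hlsc : LowerSemicontinuous b) (hfin : (Set.range b).Finite) : IsSemicontinuousLevel a := by
  obtain rfl : a = fun x => (b x : ℚ) := funext hab
  have hclosed : ∀ n : ℤ, IsClosed {x | b x ≤ n} := fun n => hlsc.isClosed_preimage n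
  refine ⟨fun x => ⟨b x, rfl⟩, ?_, ?_, ?_, ?_, ?_, ?_⟩
  · intro x y hy
    have hy' : y < (b x : ℚ) := hy
    -- For integers, `b z > b x - 1` already means `b z ≥ b x`.
    filter_upwards [hlsc x (b x - 1) (by lia)] with z hz
    refine lt_of_lt_of_le hy' ?_
    exact_mod_cast (show b x ≤ b z by lia)
  · exact Set.eq_univ_of_forall fun x => Set.mem_iUnion.2 ⟨b x, rfl⟩
  · intro m n hmn
    rw [Set.disjoint_left]
    intro x hx hx'
    simp only [Set.mem_ofPred_eq, Int.cast_inj] at hx hx'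
    exact hmn (hx.symm.trans hx')
  · intro n
    have : {x | ((b x : ℤ) : ℚ) = n} = {x | b x ≤ n} ∩ {x | b x ≤ n - 1}ᶜ := by
      ext x
      simp only [Set.mem_ofPred_eq, Int.cast_inj, Set.mem_inter_iff, Set.mem_compl_iff]
      lia
    rw [this]
    exact (hclosed n).isLocallyClosed.inter (hclosed (n - 1)).isOpen_compl.isLocallyClosed
  · refine hfin.subset ?_
    rintro n ⟨x, hx⟩
    exact ⟨x, by simpa using hx⟩
  · intro n
    refine (closure_minimal (t := {x | b x ≤ n}) ?_ (hclosed n)).trans ?_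
    · intro x hx
      simp only [Set.mem_ofPred_eq, Int.cast_inj] at hx
      exact hx.le
    · intro x hx
      simp only [Set.mem_iUnion]
      exact ⟨b x, hx, rfl⟩

theorem IsSemicontinuousLevel.comp {a : Y → ℚ} (ha : IsSemicontinuousLevel a) {f : X → Y}
    (hf : Continuous f) : IsSemicontinuousLevel fun x => a (f x) where
  integer x := ha.integer (f x)
  lowerSemicontinuous := ha.lowerSemicontinuous.comp hf
  stratified :=
    { iUnion_eq := Set.eq_univ_of_forall fun x => by
        obtain ⟨n, hn⟩ := ha.integer (f x)
        exact Set.mem_iUnion.2 ⟨n, hn⟩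
      disjoint := fun m n hmn => (ha.stratified.disjoint hmn).preimage f
      locallyClosed := fun n => (ha.stratified.locallyClosed n).preimage hf
      finite := ha.stratified.finite.subset fun _ ⟨x, hx⟩ => ⟨f x, hx⟩
      closure_subset := fun n x hx => by
        have h := ha.stratified.closure_subset n (hf.closure_preimage_subset _ hx)
        simpa using h }

variable {A : Type*} [AddCommGroup A] [Module ℂ A] [FiniteDimensional ℂ A]

/-- The level of a continuous pair of filtrations is a semicontinuous level function. -/
theorem isSemicontinuousLevel_pairLevel {h : ℤ → ℤ → ℕ} (hh : ∃ N, SupportedInBox h N)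
    {F G : X → ℤ → Submodule ℂ A} (H : ∀ x, HasMarginals h (F x) (G x))
    (hF : ∀ p, @Continuous _ _ _ (grassmannTopology A) fun x => F x p)
    (hG : ∀ p, @Continuous _ _ _ (grassmannTopology A) fun x => G x p) :
    IsSemicontinuousLevel fun x => pairLevel h (F x) (G x) := by
  let : TopologicalSpace A := moduleTopology ℂ A
  have : IsModuleTopology ℂ A := ⟨rfl⟩
  let := grassmannTopology A
  obtain ⟨N₀, hN₀⟩ := hh
  obtain ⟨N, hN, hbox⟩ : ∃ N, 0 ≤ N ∧ SupportedInBox h N := by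
    refine ⟨max N₀ 0, le_max_right _ _, fun p q hpq => ?_⟩
    have := hN₀ p q hpq
    simp only [Finset.mem_Ico] at this ⊢
    lia
  refine isSemicontinuousLevel_of_bounded (fun x => (H x).pairLevel_eq hN hbox) ?_ ?_
  · intro x
    have h1 : ∀ᶠ y in 𝓝 x, ∀ p ∈ Finset.Ico (-N) N, ∀ q ∈ Finset.Ico (-N) N,
        infDim (F y) (G y) (p + 1) (q + 1) ≤ infDim (F x) (G x) (p + 1) (q + 1) := by
      rw [Filter.eventually_all_finset]
      intro p _
      rw [Filter.eventually_all_finset]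
      intro q _
      filter_upwards [eventually_finrank_inf_le ((hF (p + 1)).tendsto x)
        ((hG (q + 1)).tendsto x)] with y hy
      exact Nat.cast_le.2 hy
    intro n hn
    filter_upwards [h1] with y hy
    refine lt_of_lt_of_le hn ?_
    refine Finset.sum_le_sum fun p hp => Finset.sum_le_sum fun q hq => ?_
    have := hy p hp q hq
    lia
  -- Each intersection has dimension between `0` and `dim A`, and everything else in the formula is
  -- constant.
  · refine (Set.finite_Icc
      (∑ p ∈ Finset.Ico (-N) N, ∑ q ∈ Finset.Ico (-N) N,
        ((p + N) * (q + N) * (h p q : ℤ) - Module.finrank ℂ A))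
      (∑ p ∈ Finset.Ico (-N) N, ∑ q ∈ Finset.Ico (-N) N,
        ((p + N) * (q + N) * (h p q : ℤ)))).subset ?_
    rintro _ ⟨x, rfl⟩
    constructor <;> refine Finset.sum_le_sum fun p hp => Finset.sum_le_sum fun q hq => ?_
    · have : infDim (F x) (G x) (p + 1) (q + 1) ≤ Module.finrank ℂ A := by
        exact Nat.cast_le.2 (Submodule.finrank_le _)
      lia
    · have : 0 ≤ infDim (F x) (G x) (p + 1) (q + 1) := Nat.cast_nonneg _
      lia

end Semicontinuity

/-! ### Conjugation -/

section Conjugation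

variable {V : Type*} [AddCommGroup V] [Module ℝ V]

@[simp]
theorem conj_tmul (z : ℂ) (v : V) : conj V (z ⊗ₜ v) = (starRingEnd ℂ z) ⊗ₜ[ℝ] v := rfl

@[simp]
theorem conj_conj (x : ℂ ⊗[ℝ] V) : conj V (conj V x) = x := by
  induction x using TensorProduct.induction_on with
  | zero => simp
  | tmul a v => simp
  | add x y hx hy => rw [map_add, map_add, hx, hy]

theorem conj_injective : Function.Injective (conj V) :=
  Function.LeftInverse.injective conj_conj

theorem conj_surjective : Function.Surjective (conj V) :=
  Function.RightInverse.surjective conj_conj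

theorem linearIndependent_conj {ι : Type*} {v : ι → ℂ ⊗[ℝ] V} (hv : LinearIndependent ℂ v) :
    LinearIndependent ℂ fun i => conj V (v i) :=
  hv.map_of_surjective_injectiveₛ (starRingEnd ℂ) (conj V).toAddMonoidHom
    (RingHomSurjective.is_surjective) conj_injective fun r m => map_smulₛₗ (conj V) r m

theorem linearIndependent_conj_iff {ι : Type*} {v : ι → ℂ ⊗[ℝ] V} :
    LinearIndependent ℂ (fun i => conj V (v i)) ↔ LinearIndependent ℂ v :=
  ⟨fun h => by simpa using linearIndependent_conj h, linearIndependent_conj⟩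

theorem map_conj_span {ι : Type*} (v : ι → ℂ ⊗[ℝ] V) :
    (Submodule.span ℂ (Set.range v)).map (conj V) =
      Submodule.span ℂ (Set.range fun i => conj V (v i)) := by
  rw [Submodule.map_span, ← Set.range_comp]
  rfl

/-- Conjugation is only semilinear, so dimensions are compared by conjugating a frame. -/
theorem finrank_map_conj [FiniteDimensional ℝ V] (U : Submodule ℂ (ℂ ⊗[ℝ] V)) :
    Module.finrank ℂ (U.map (conj V)) = Module.finrank ℂ U := by
  obtain ⟨v, hv, hvU⟩ := exists_fin_frame U
  conv_lhs => rw [← hvU]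
  rw [map_conj_span, finrank_span_eq_card (linearIndependent_conj hv), Fintype.card_fin]

/-- Conjugation is continuous on vectors and preserves independence, so it acts continuously on
frames, by which the topology is defined. -/
theorem continuous_map_conj [FiniteDimensional ℝ V] :
    @Continuous _ _ (grassmannTopology (ℂ ⊗[ℝ] V)) (grassmannTopology (ℂ ⊗[ℝ] V))
      (fun U => U.map (conj V)) := by
  let : TopologicalSpace (ℂ ⊗[ℝ] V) := moduleTopology ℂ _
  have : IsModuleTopology ℂ (ℂ ⊗[ℝ] V) := ⟨rfl⟩
  have := IsModuleTopology.toContinuousAdd ℂ (ℂ ⊗[ℝ] V)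
  have hc : Continuous (conj V) :=
    IsModuleTopology.continuous_of_linearMapₛₗ Complex.continuous_conj (conj V)
  let := grassmannTopology (ℂ ⊗[ℝ] V)
  rw [continuous_def]
  intro O hO
  rw [isOpen_grassmann_iff]
  intro k
  have h := (isOpen_grassmann_iff.1 hO k).preimage
    (f := fun v : Fin k → ℂ ⊗[ℝ] V => fun i => conj V (v i)) (by fun_prop)
  convert h using 1
  ext v
  simp only [Set.mem_ofPred_eq, Set.mem_preimage, map_conj_span, linearIndependent_conj_iff]

theorem IsFiniteDecreasing.conjFil {F : ℤ → Submodule ℂ (ℂ ⊗[ℝ] V)} (hF : IsFiniteDecreasing F) :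
    IsFiniteDecreasing (conjFil F) where
  antitone _ _ h := Submodule.map_mono (hF.antitone h)
  exists_top := by
    obtain ⟨p, hp⟩ := hF.exists_top
    refine ⟨p, ?_⟩
    rw [SplitLevel.conjFil, hp, Submodule.map_top, LinearMap.range_eq_top]
    exact conj_surjective
  exists_bot := by
    obtain ⟨p, hp⟩ := hF.exists_bot
    exact ⟨p, by rw [SplitLevel.conjFil, hp, Submodule.map_bot]⟩

end Conjugation

/-! ### Hodge numbers -/

section HodgeNumbers

variable {V : Type*} [AddCommGroup V] [Module ℝ V]

theorem baseChange_injective {V' : Type*} [AddCommGroup V'] [Module ℝ V'] {f : V →ₗ[ℝ] V'}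
    (hf : Function.Injective f) : Function.Injective (f.baseChange ℂ) := by
  rw [LinearMap.baseChange_eq_ltensor]
  exact Module.Flat.lTensor_preserves_injective_linearMap f hf

/-- The complexification of the `k`-th step of the weight filtration. -/
noncomputable def complexW (W : ℤ → Submodule ℝ V) (k : ℤ) : Submodule ℂ (ℂ ⊗[ℝ] V) :=
  LinearMap.range ((W k).subtype.baseChange ℂ)

theorem complexW_eq_bot {W : ℤ → Submodule ℝ V} {k : ℤ} (h : W k = ⊥) : complexW W k = ⊥ := by
  have : (W k).subtype = 0 := by
    ext x
    exact (Submodule.mem_bot ℝ).1 (h.le x.2)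
  rw [complexW, this, LinearMap.baseChange_zero, LinearMap.range_zero]

theorem complexW_eq_top {W : ℤ → Submodule ℝ V} {k : ℤ} (h : W k = ⊤) : complexW W k = ⊤ := by
  rw [complexW, LinearMap.range_eq_top, LinearMap.baseChange_eq_ltensor]
  refine LinearMap.lTensor_surjective _ fun x => ?_
  exact ⟨⟨x, h ▸ Submodule.mem_top⟩, rfl⟩

/-- By exactness of the tensor product, the kernel of `ℂ ⊗ W_k → ℂ ⊗ Gr^W_k` comes from `ℂ ⊗
W_{k-1}`. -/
theorem map_ker_mkQ_baseChange {W : ℤ → Submodule ℝ V} (hW : Monotone W) (k : ℤ) :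
    (LinearMap.ker (((W (k - 1)).submoduleOf (W k)).mkQ.baseChange ℂ)).map
      ((W k).subtype.baseChange ℂ) = complexW W (k - 1) := by
  set P := (W (k - 1)).submoduleOf (W k)
  have hker : LinearMap.ker (P.mkQ.baseChange ℂ) = LinearMap.range (P.subtype.baseChange ℂ) := by
    ext x
    rw [LinearMap.mem_ker, LinearMap.mem_range]
    exact lTensor_exact ℂ (LinearMap.exact_subtype_mkQ P) P.mkQ_surjective x
  let e : P ≃ₗ[ℝ] W (k - 1) := Submodule.submoduleOfEquivOfLe (hW (by lia))
  have he : (W k).subtype ∘ₗ P.subtype = (W (k - 1)).subtype ∘ₗ e.toLinearMap := rfl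
  have hes : Function.Surjective (e.toLinearMap.baseChange ℂ) := by
    rw [LinearMap.baseChange_eq_ltensor]
    exact LinearMap.lTensor_surjective _ e.surjective
  rw [hker, ← LinearMap.range_comp, ← LinearMap.baseChange_comp, he, LinearMap.baseChange_comp,
    LinearMap.range_comp_of_range_eq_top _ (LinearMap.range_eq_top.2 hes)]
  rfl

theorem inducedGrW_antitone (W : ℤ → Submodule ℝ V) {F : ℤ → Submodule ℂ (ℂ ⊗[ℝ] V)}
    (hF : Antitone F) (k : ℤ) : Antitone (inducedGrW W F k) := fun _ _ h =>
  Submodule.map_mono (Submodule.comap_mono (hF h))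

/-- A finite increasing filtration. -/
structure IsFiniteIncreasing (W : ℤ → Submodule ℝ V) : Prop where
  monotone : Monotone W
  exists_top : ∃ k, W k = ⊤
  exists_bot : ∃ k, W k = ⊥

theorem IsFiniteIncreasing.exists_bounds {W : ℤ → Submodule ℝ V} (hW : IsFiniteIncreasing W) :
    ∃ a b, a ≤ b ∧ (∀ k < a, complexW W k = ⊥) ∧ ∀ k, b ≤ k → complexW W k = ⊤ := by
  obtain ⟨b, hb⟩ := hW.exists_top
  obtain ⟨a, ha⟩ := hW.exists_bot
  refine ⟨a, max a b, le_max_left _ _, fun k hk => complexW_eq_bot ?_,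
    fun k hk => complexW_eq_top ?_⟩
  · exact eq_bot_iff.2 (ha ▸ hW.monotone hk.le)
  · exact eq_top_iff.2 (hb ▸ hW.monotone ((le_max_right a b).trans hk))

variable [FiniteDimensional ℝ V]

/-- Rank-nullity on `ℂ ⊗ W_k`, moved along its injection into `ℂ ⊗ V`, so that all dimensions refer
to one ambient space and telescope in `k`. -/
theorem finrank_inducedGrW {W : ℤ → Submodule ℝ V} (hW : Monotone W)
    (F : ℤ → Submodule ℂ (ℂ ⊗[ℝ] V)) (k p : ℤ) :
    (Module.finrank ℂ (inducedGrW W F k p) : ℤ) =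
      infDim F (complexW W) p k - infDim F (complexW W) p (k - 1) := by
  set ι := (W k).subtype.baseChange ℂ with hι
  have hinj : Function.Injective ι := baseChange_injective (W k).injective_subtype
  have hfin : ∀ U : Submodule ℂ (ℂ ⊗[ℝ] W k),
      Module.finrank ℂ (U.map ι) = Module.finrank ℂ U := fun U =>
    (LinearEquiv.finrank_eq (Submodule.equivMapOfInjective ι hinj U)).symm
  have h := finrank_map_add_finrank_inf_ker (((W (k - 1)).submoduleOf (W k)).mkQ.baseChange ℂ)
    ((F p).comap ι)
  have hle : complexW W (k - 1) ≤ complexW W k := by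
    rw [← map_ker_mkQ_baseChange hW]
    exact LinearMap.map_le_range
  rw [← hfin ((F p).comap ι), ← hfin (_ ⊓ _), Submodule.map_inf _ hinj,
    map_ker_mkQ_baseChange hW, Submodule.map_comap_eq, inf_comm (LinearMap.range ι), inf_assoc,
    show LinearMap.range ι = complexW W k from rfl, inf_eq_right.2 hle] at h
  rw [inducedGrW, infDim, infDim, ← h]
  push_cast
  ring

theorem hodgeNumber_eq (W : ℤ → Submodule ℝ V) {F : ℤ → Submodule ℂ (ℂ ⊗[ℝ] V)}
    (hF : Antitone F) (p q : ℤ) : (hodgeNumber W F p q : ℤ) =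
      (Module.finrank ℂ (inducedGrW W F (p + q) p) : ℤ) -
        Module.finrank ℂ (inducedGrW W F (p + q) (p + 1)) :=
  finrank_gr (inducedGrW_antitone W hF _) p

theorem hodgeNumber_eq_infDim {W : ℤ → Submodule ℝ V} (hW : Monotone W)
    {F : ℤ → Submodule ℂ (ℂ ⊗[ℝ] V)} (hF : Antitone F) (p q : ℤ) : (hodgeNumber W F p q : ℤ) =
      (infDim F (complexW W) p (p + q) - infDim F (complexW W) (p + 1) (p + q)) -
      (infDim F (complexW W) p (p + q - 1) - infDim F (complexW W) (p + 1) (p + q - 1)) := by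
  rw [hodgeNumber_eq W hF, finrank_inducedGrW hW, finrank_inducedGrW hW]
  ring

/-- For fixed `p`, summing over `q` is summing over the weight `k = p + q`, and the sum telescopes
along `W`. -/
theorem finsum_hodgeNumber {W : ℤ → Submodule ℝ V} (hW : IsFiniteIncreasing W)
    {F : ℤ → Submodule ℂ (ℂ ⊗[ℝ] V)} (hF : Antitone F) (p : ℤ) :
    ∑ᶠ q, (hodgeNumber W F p q : ℤ) =
      (Module.finrank ℂ (F p) : ℤ) - Module.finrank ℂ (F (p + 1)) := by
  obtain ⟨a, b, hab, ha, hb⟩ := hW.exists_bounds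
  let g : ℤ → ℤ := fun k => infDim F (complexW W) p k - infDim F (complexW W) (p + 1) k
  have h1 : ∀ q, (hodgeNumber W F p q : ℤ) = g (Equiv.addLeft p q) - g (Equiv.addLeft p q - 1) :=
    fun q => hodgeNumber_eq_infDim hW.monotone hF p q
  rw [finsum_congr h1, finsum_comp_equiv (Equiv.addLeft p) (f := fun k => g k - g (k - 1))]
  refine finsum_sub_sub_one g hab (fun k hk => ?_) (fun k hk => ?_)
  · dsimp only [g, infDim]
    rw [ha k hk, inf_bot_eq, inf_bot_eq, sub_self]
  · dsimp only [g, infDim]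
    rw [hb k hk, inf_top_eq, inf_top_eq]

theorem exists_supportedInBox_hodgeNumber {W : ℤ → Submodule ℝ V} (hW : IsFiniteIncreasing W)
    {F : ℤ → Submodule ℂ (ℂ ⊗[ℝ] V)} (hF : IsFiniteDecreasing F) :
    ∃ N, SupportedInBox (hodgeNumber W F) N := by
  obtain ⟨a, b, hab, ha, hb⟩ := hW.exists_bounds
  obtain ⟨c, hc⟩ := hF.exists_top
  obtain ⟨d, hd⟩ := hF.exists_bot
  -- A nonzero Hodge number forces `a ≤ p + q ≤ b` and `c ≤ p < d`, hence bounds on `q` too; the `1`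
  -- serves the half-open upper end.
  refine ⟨|a| + |b| + |c| + |d| + 1, fun p q hpq => ?_⟩
  have hpq' : (hodgeNumber W F p q : ℤ) ≠ 0 := by exact_mod_cast hpq
  rw [hodgeNumber_eq_infDim hW.monotone hF.antitone] at hpq'
  have h1 : a ≤ p + q := by
    by_contra h
    apply hpq'
    simp only [infDim]
    rw [ha (p + q) (by lia), ha (p + q - 1) (by lia)]
    simp only [sub_self]
  have h2 : p + q ≤ b := by
    by_contra h
    apply hpq'
    simp only [infDim]
    rw [hb (p + q) (by lia), hb (p + q - 1) (by lia), sub_self]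
  have h3 : c ≤ p := by
    by_contra h
    apply hpq'
    simp only [infDim]
    have e1 : F p = ⊤ := top_unique (hc ▸ hF.antitone (by lia))
    have e2 : F (p + 1) = ⊤ := top_unique (hc ▸ hF.antitone (by lia))
    rw [e1, e2]
    ring
  have h4 : p < d := by
    by_contra h
    apply hpq'
    simp only [infDim]
    have e1 : F p = ⊥ := bot_unique (hd ▸ hF.antitone (by lia))
    have e2 : F (p + 1) = ⊥ := bot_unique (hd ▸ hF.antitone (by lia))
    rw [e1, e2]
    ring
  have := le_abs_self b
  have := neg_abs_le a
  have := neg_abs_le c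
  have := le_abs_self d
  have := abs_nonneg a
  have := abs_nonneg b
  have := abs_nonneg c
  have := abs_nonneg d
  simp only [Finset.mem_Ico]
  lia

/-- Opposedness makes the dimensions of `F^r` and `F^{k+1-r}` on `Gr^W_k` add up to the whole.
Comparing `r = p` with `r = p + 1`, for `k = p + q`, gives the symmetry. -/
theorem IsGradedPolarizedMHS.hodgeNumber_symm {W : ℤ → Submodule ℝ V}
    {Q : ∀ k, LinearMap.BilinForm ℝ (GrW W k)} {F : ℤ → Submodule ℂ (ℂ ⊗[ℝ] V)}
    (hF : IsGradedPolarizedMHS W Q F) (p q : ℤ) : hodgeNumber W F p q = hodgeNumber W F q p := by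
  have key : ∀ k r, Module.finrank ℂ (inducedGrW W F k r) +
      Module.finrank ℂ (inducedGrW W F k (k + 1 - r)) = Module.finrank ℂ (ℂ ⊗[ℝ] GrW W k) := by
    intro k r
    have h := Submodule.finrank_add_eq_of_isCompl ((hF.graded k).opposed r)
    rwa [conjFil, finrank_map_conj] at h
  have h1 := hodgeNumber_eq W hF.finite.antitone p q
  have h2 := hodgeNumber_eq W hF.finite.antitone q p
  have h3 := key (p + q) p
  have h4 := key (p + q) (p + 1)
  rw [add_comm q p] at h2
  rw [show p + q + 1 - p = q + 1 by ring] at h3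
  rw [show p + q + 1 - (p + 1) = q by ring] at h4
  lia

theorem IsGradedPolarizedMHS.finsum_hodgeNumber_left {W : ℤ → Submodule ℝ V}
    (hW : IsFiniteIncreasing W) {Q : ∀ k, LinearMap.BilinForm ℝ (GrW W k)}
    {F : ℤ → Submodule ℂ (ℂ ⊗[ℝ] V)} (hF : IsGradedPolarizedMHS W Q F) (q : ℤ) :
    ∑ᶠ p, (hodgeNumber W F p q : ℤ) =
      (Module.finrank ℂ (F q) : ℤ) - Module.finrank ℂ (F (q + 1)) := by
  rw [← finsum_hodgeNumber hW hF.finite.antitone q]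
  exact finsum_congr fun p => by rw [hF.hodgeNumber_symm]

end HodgeNumbers

/-! ### Levels on the classifying space -/

section Classifying

variable {V : Type*} [AddCommGroup V] [Module ℝ V]
  {W : ℤ → Submodule ℝ V} {Q : ∀ k, LinearMap.BilinForm ℝ (GrW W k)} {h : ℤ → ℤ → ℕ}

theorem ClassifyingSpace.continuous_eval (p : ℤ) :
    @Continuous (ClassifyingSpace W Q h) _ _ (grassmannTopology _) fun z => z.1 p := by
  let := grassmannTopology (ℂ ⊗[ℝ] V)
  exact (continuous_apply p).comp continuous_induced_dom

theorem ClassifyingSpace.hodgeNumber_eq (z : ClassifyingSpace W Q h) : hodgeNumber W z.1 = h :=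
  funext₂ z.2.2

variable [FiniteDimensional ℝ V]

theorem isSemicontinuousLevel_pairLevel_classifyingSpace (hW : IsFiniteIncreasing W)
    (hh : ∃ N, SupportedInBox h N) :
    IsSemicontinuousLevel fun z : ClassifyingSpace W Q h × ClassifyingSpace W Q h =>
      pairLevel h z.1.1 z.2.1 := by
  let := grassmannTopology (ℂ ⊗[ℝ] V)
  refine isSemicontinuousLevel_pairLevel hh (fun z => ?_)
    (fun p => (ClassifyingSpace.continuous_eval p).comp continuous_fst)
    (fun p => (ClassifyingSpace.continuous_eval p).comp continuous_snd)
  refine ⟨z.1.2.1.finite, z.2.2.1.finite, fun p => ?_, fun q => ?_⟩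
  · rw [← finsum_hodgeNumber hW z.1.2.1.finite.antitone, z.1.hodgeNumber_eq]
  · rw [← z.2.2.1.finsum_hodgeNumber_left hW, z.2.hodgeNumber_eq]

/-- The conjugate filtration depends continuously on `F` and has the same dimensions, so it
qualifies as the second filtration of the pair. -/
theorem isSemicontinuousLevel_splitLevel_classifyingSpace (hW : IsFiniteIncreasing W)
    (hh : ∃ N, SupportedInBox h N) :
    IsSemicontinuousLevel fun z : ClassifyingSpace W Q h => splitLevel W z.1 := by
  let := grassmannTopology (ℂ ⊗[ℝ] V)
  have e : (fun z : ClassifyingSpace W Q h => splitLevel W z.1) =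
      fun z => pairLevel h z.1 (conjFil z.1) := funext fun z => by
    rw [splitLevel, z.hodgeNumber_eq]
  rw [e]
  refine isSemicontinuousLevel_pairLevel hh (fun z => ?_) ClassifyingSpace.continuous_eval
    (fun p => continuous_map_conj.comp (ClassifyingSpace.continuous_eval p))
  refine ⟨z.2.1.finite, z.2.1.finite.conjFil, fun p => ?_, fun q => ?_⟩
  · rw [← finsum_hodgeNumber hW z.2.1.finite.antitone, z.hodgeNumber_eq]
  · rw [conjFil, conjFil, finrank_map_conj, finrank_map_conj,
      ← z.2.1.finsum_hodgeNumber_left hW, z.hodgeNumber_eq]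

end Classifying

/-! ### Transport of structure -/

section Transport

variable {V V' : Type*} [AddCommGroup V] [Module ℝ V] [AddCommGroup V'] [Module ℝ V']

theorem conj_baseChange (f : V →ₗ[ℝ] V') (x : ℂ ⊗[ℝ] V) :
    conj V' (f.baseChange ℂ x) = f.baseChange ℂ (conj V x) := by
  induction x using TensorProduct.induction_on with
  | zero => simp
  | tmul a v => simp
  | add x y hx hy => simp only [map_add, hx, hy]

/-- The image of a filtration of `ℂ ⊗ V` under a real isomorphism. -/
noncomputable def mapFil (τ : V ≃ₗ[ℝ] V') (F : ℤ → Submodule ℂ (ℂ ⊗[ℝ] V)) (p : ℤ) :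
    Submodule ℂ (ℂ ⊗[ℝ] V') :=
  (F p).map (τ.toLinearMap.baseChange ℂ)

theorem baseChange_equiv_injective (τ : V ≃ₗ[ℝ] V') :
    Function.Injective (τ.toLinearMap.baseChange ℂ) :=
  baseChange_injective τ.injective

theorem baseChange_equiv_surjective (τ : V ≃ₗ[ℝ] V') :
    Function.Surjective (τ.toLinearMap.baseChange ℂ) := by
  rw [LinearMap.baseChange_eq_ltensor]
  exact LinearMap.lTensor_surjective _ τ.surjective

theorem finrank_map_baseChange (τ : V ≃ₗ[ℝ] V') (U : Submodule ℂ (ℂ ⊗[ℝ] V)) :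
    Module.finrank ℂ (U.map (τ.toLinearMap.baseChange ℂ)) = Module.finrank ℂ U :=
  (LinearEquiv.finrank_eq
    (Submodule.equivMapOfInjective _ (baseChange_equiv_injective τ) U)).symm

theorem conjFil_mapFil (τ : V ≃ₗ[ℝ] V') (F : ℤ → Submodule ℂ (ℂ ⊗[ℝ] V)) :
    conjFil (mapFil τ F) = mapFil τ (conjFil F) := by
  ext p x
  simp only [conjFil, mapFil, Submodule.mem_map, exists_exists_and_eq_and, conj_baseChange]

theorem IsFiniteDecreasing.mapFil {F : ℤ → Submodule ℂ (ℂ ⊗[ℝ] V)} (hF : IsFiniteDecreasing F)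
    (τ : V ≃ₗ[ℝ] V') : IsFiniteDecreasing (mapFil τ F) where
  antitone _ _ h := Submodule.map_mono (hF.antitone h)
  exists_top := by
    obtain ⟨p, hp⟩ := hF.exists_top
    refine ⟨p, ?_⟩
    rw [SplitLevel.mapFil, hp, Submodule.map_top, LinearMap.range_eq_top]
    exact baseChange_equiv_surjective τ
  exists_bot := by
    obtain ⟨p, hp⟩ := hF.exists_bot
    exact ⟨p, by rw [SplitLevel.mapFil, hp, Submodule.map_bot]⟩

theorem baseChange_form_map (τ : V →ₗ[ℝ] V') {Q : LinearMap.BilinForm ℝ V}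
    {Q' : LinearMap.BilinForm ℝ V'} (h : ∀ u v, Q' (τ u) (τ v) = Q u v) (x y : ℂ ⊗[ℝ] V) :
    Q'.baseChange ℂ (τ.baseChange ℂ x) (τ.baseChange ℂ y) = Q.baseChange ℂ x y := by
  induction x using TensorProduct.induction_on with
  | zero => simp
  | add x x' hx hx' => simp only [map_add, LinearMap.add_apply, hx, hx']
  | tmul a u =>
    induction y using TensorProduct.induction_on with
    | zero => simp
    | add y y' hy hy' => simp only [map_add, hy, hy']
    | tmul b v => simp [h]

theorem IsPolarizedHodge.mapFil {k : ℤ} {F : ℤ → Submodule ℂ (ℂ ⊗[ℝ] V)}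
    {Q : LinearMap.BilinForm ℝ V} (hF : IsPolarizedHodge k F Q) (τ : V ≃ₗ[ℝ] V')
    {Q' : LinearMap.BilinForm ℝ V'} (h : ∀ u v, Q' (τ u) (τ v) = Q u v) :
    IsPolarizedHodge k (mapFil τ F) Q' where
  finite := hF.finite.mapFil τ
  opposed p := by
    rw [conjFil_mapFil]
    have hc := hF.opposed p
    refine ⟨Submodule.disjoint_map (baseChange_equiv_injective τ) hc.disjoint, ?_⟩
    rw [codisjoint_iff, SplitLevel.mapFil, SplitLevel.mapFil, ← Submodule.map_sup,
      hc.sup_eq_top, Submodule.map_top, LinearMap.range_eq_top]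
    exact baseChange_equiv_surjective τ
  symm u v := by
    obtain ⟨u, rfl⟩ := τ.surjective u
    obtain ⟨v, rfl⟩ := τ.surjective v
    rw [h, h, hF.symm]
  riemann₁ := by
    rintro p _ ⟨u, hu, rfl⟩ _ ⟨v, hv, rfl⟩
    exact (baseChange_form_map τ.toLinearMap h u v).trans (hF.riemann₁ p u hu v hv)
  riemann₂ := by
    rintro p q hpq x hx hx0
    rw [conjFil_mapFil, SplitLevel.mapFil, SplitLevel.mapFil,
      ← Submodule.map_inf _ (baseChange_equiv_injective τ)] at hx
    obtain ⟨u, hu, rfl⟩ := hx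
    rw [conj_baseChange, baseChange_form_map τ.toLinearMap h]
    exact hF.riemann₂ p q hpq u hu fun h0 => hx0 (by rw [h0, map_zero])

variable {W : ℤ → Submodule ℝ V} {W' : ℤ → Submodule ℝ V'}

/-- The isomorphism of the graded pieces induced by a filtered isomorphism. -/
noncomputable def grEquiv (τ : V ≃ₗ[ℝ] V') (hW : ∀ k, (W k).map τ.toLinearMap = W' k) (k : ℤ) :
    GrW W k ≃ₗ[ℝ] GrW W' k :=
  Submodule.Quotient.equiv _ _ (τ.ofSubmodules (W k) (W' k) (hW k)) (by
    ext x
    simp only [Submodule.mem_map, Submodule.submoduleOf, Submodule.mem_comap,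
      Submodule.subtype_apply, ← hW (k - 1)]
    constructor
    · rintro ⟨y, hy, rfl⟩
      exact ⟨y, hy, rfl⟩
    · rintro ⟨y, hy, hyx⟩
      -- Monotonicity of `W` is not assumed, so `y ∈ W k` is deduced from injectivity of `τ`.
      have hxk : x.1 ∈ (W k).map τ.toLinearMap := (hW k).ge x.2
      obtain ⟨z, hz, hzx⟩ := hxk
      obtain rfl : y = z := τ.injective (hyx.trans hzx.symm)
      exact ⟨⟨y, hz⟩, hy, Subtype.ext hyx⟩)

theorem inducedGrW_mapFil (τ : V ≃ₗ[ℝ] V') (hW : ∀ k, (W k).map τ.toLinearMap = W' k)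
    (F : ℤ → Submodule ℂ (ℂ ⊗[ℝ] V)) (k : ℤ) :
    inducedGrW W' (mapFil τ F) k = mapFil (grEquiv τ hW k) (inducedGrW W F k) := by
  funext p
  let σ := τ.ofSubmodules (W k) (W' k) (hW k)
  have h1 : ((W' k).subtype.baseChange ℂ) ∘ₗ (σ.toLinearMap.baseChange ℂ) =
      (τ.toLinearMap.baseChange ℂ) ∘ₗ ((W k).subtype.baseChange ℂ) := by
    rw [← LinearMap.baseChange_comp, ← LinearMap.baseChange_comp]
    rfl
  have h2 : (((W' (k - 1)).submoduleOf (W' k)).mkQ.baseChange ℂ) ∘ₗ (σ.toLinearMap.baseChange ℂ) =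
      ((grEquiv τ hW k).toLinearMap.baseChange ℂ) ∘ₗ
        (((W (k - 1)).submoduleOf (W k)).mkQ.baseChange ℂ) := by
    rw [← LinearMap.baseChange_comp, ← LinearMap.baseChange_comp]
    rfl
  rw [mapFil, inducedGrW, inducedGrW, ← Submodule.map_comp, ← h2, Submodule.map_comp]
  congr 1
  ext x
  obtain ⟨x, rfl⟩ := baseChange_equiv_surjective σ x
  have h3 := LinearMap.congr_fun h1 x
  rw [LinearMap.comp_apply, LinearMap.comp_apply] at h3
  rw [Submodule.mem_comap, h3, mapFil]
  erw [(baseChange_equiv_injective τ).mem_set_image, (baseChange_equiv_injective σ).mem_set_image]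
  rfl

theorem hodgeNumber_mapFil [FiniteDimensional ℝ V] [FiniteDimensional ℝ V'] (τ : V ≃ₗ[ℝ] V')
    (hW : ∀ k, (W k).map τ.toLinearMap = W' k)
    {F : ℤ → Submodule ℂ (ℂ ⊗[ℝ] V)} (hF : IsFiniteDecreasing F) (p q : ℤ) :
    hodgeNumber W' (mapFil τ F) p q = hodgeNumber W F p q := by
  have h1 := hodgeNumber_eq W hF.antitone p q
  have h2 := hodgeNumber_eq W' (hF.mapFil τ).antitone p q
  rw [inducedGrW_mapFil τ hW, mapFil, mapFil, finrank_map_baseChange,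
    finrank_map_baseChange] at h2
  exact_mod_cast h2.trans h1.symm

theorem bigradedDim_mapFil [FiniteDimensional ℝ V] [FiniteDimensional ℝ V'] (τ : V ≃ₗ[ℝ] V')
    {F G : ℤ → Submodule ℂ (ℂ ⊗[ℝ] V)} (hF : IsFiniteDecreasing F) (hG : IsFiniteDecreasing G)
    (p q : ℤ) : bigradedDim (mapFil τ F) (mapFil τ G) p q = bigradedDim F G p q := by
  have h : ∀ p q, infDim (mapFil τ F) (mapFil τ G) p q = infDim F G p q := fun p q => by
    rw [infDim, infDim, mapFil, mapFil, ← Submodule.map_inf _ (baseChange_equiv_injective τ),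
      finrank_map_baseChange]
  have h1 := bigradedDim_eq hF.antitone hG.antitone p q
  have h2 := bigradedDim_eq (hF.mapFil τ).antitone (hG.mapFil τ).antitone p q
  rw [h, h, h, h, ← h1] at h2
  exact_mod_cast h2

/-- Being real, `τ` commutes with conjugation, so both `h` and `s` are preserved. -/
theorem splitLevel_mapFil [FiniteDimensional ℝ V] [FiniteDimensional ℝ V'] (τ : V ≃ₗ[ℝ] V')
    (hW : ∀ k, (W k).map τ.toLinearMap = W' k)
    {F : ℤ → Submodule ℂ (ℂ ⊗[ℝ] V)} (hF : IsFiniteDecreasing F) :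
    splitLevel W' (mapFil τ F) = splitLevel W F := by
  simp only [splitLevel, pairLevel, conjFil_mapFil, hodgeNumber_mapFil τ hW hF,
    bigradedDim_mapFil τ hF hF.conjFil]

theorem IsGradedPolarizedMHS.mapFil {Q : ∀ k, LinearMap.BilinForm ℝ (GrW W k)}
    {F : ℤ → Submodule ℂ (ℂ ⊗[ℝ] V)} (hF : IsGradedPolarizedMHS W Q F) (τ : V ≃ₗ[ℝ] V')
    (hW : ∀ k, (W k).map τ.toLinearMap = W' k) {Q' : ∀ k, LinearMap.BilinForm ℝ (GrW W' k)}
    (hQ : ∀ k u v, Q' k (grEquiv τ hW k u) (grEquiv τ hW k v) = Q k u v) :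
    IsGradedPolarizedMHS W' Q' (mapFil τ F) where
  finite := hF.finite.mapFil τ
  graded k := by
    rw [inducedGrW_mapFil τ hW]
    exact (hF.graded k).mapFil _ (hQ k)

end Transport

/-! ### Trivializations of local systems -/

namespace LocalSystem

section Frames

variable {S : Type u} [TopologicalSpace S] (L : LocalSystem.{u, w} S)
  (V₀ : Type w) [AddCommGroup V₀] [Module ℝ V₀]

/-- The cocycle relation at `x, x, x` makes this map idempotent, and it is injective. -/
theorem transport_self (x : S) : L.transport x x = LinearMap.id := by
  have h1 := (L.bijective x).self_of_nhds
  have h2 := (L.cocycle x).self_of_nhds.self_of_nhds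
  ext u
  exact h1.1 (LinearMap.congr_fun h2 u).symm

/-- The space of pairs of a point and an isomorphism of the fibre there with `V₀`. -/
def FrameSpace : Type _ := Σ s, L.Fiber s ≃ₗ[ℝ] V₀

/-- A set of frames is open if it contains all parallel frames near each of its elements. -/
instance : TopologicalSpace (FrameSpace L V₀) where
  IsOpen O := ∀ s e, (⟨s, e⟩ : Σ s, L.Fiber s ≃ₗ[ℝ] V₀) ∈ O → ∀ᶠ s' in 𝓝 s,
    ∀ e' : L.Fiber s' ≃ₗ[ℝ] V₀, e'.toLinearMap ∘ₗ L.transport s s' = e.toLinearMap →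
      (⟨s', e'⟩ : Σ s, L.Fiber s ≃ₗ[ℝ] V₀) ∈ O
  isOpen_univ _ _ _ := Filter.Eventually.of_forall fun _ _ _ => trivial
  isOpen_inter O O' hO hO' s e he := by
    filter_upwards [hO s e he.1, hO' s e he.2] with s' h h' e' he'
    exact ⟨h e' he', h' e' he'⟩
  isOpen_sUnion C hC s e he := by
    obtain ⟨O, hO, heO⟩ := he
    filter_upwards [hC O hO s e heO] with s' h e' he'
    exact ⟨O, hO, h e' he'⟩

variable {L V₀}

theorem FrameSpace.isOpen_iff {O : Set (FrameSpace L V₀)} :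
    IsOpen O ↔ ∀ s e, (⟨s, e⟩ : Σ s, L.Fiber s ≃ₗ[ℝ] V₀) ∈ O → ∀ᶠ s' in 𝓝 s,
      ∀ e' : L.Fiber s' ≃ₗ[ℝ] V₀, e'.toLinearMap ∘ₗ L.transport s s' = e.toLinearMap →
        (⟨s', e'⟩ : Σ s, L.Fiber s ≃ₗ[ℝ] V₀) ∈ O := Iff.rfl

variable (L V₀)

/-- The projection of the space of frames to the base. -/
def FrameSpace.proj (z : FrameSpace L V₀) : S := z.1

/-- The points near `x` at which the flat trivialization at `x` is a flat isomorphism. -/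
def flatDomain (x : S) : Set S :=
  interior {y | Function.Bijective (L.transport x y) ∧
    ∀ᶠ z in 𝓝 y, L.transport x z = L.transport y z ∘ₗ L.transport x y}

theorem mem_flatDomain (x : S) : x ∈ L.flatDomain x :=
  mem_interior_iff_mem_nhds.2 ((L.bijective x).and (L.cocycle x))

theorem isOpen_flatDomain (x : S) : IsOpen (L.flatDomain x) := isOpen_interior

variable {L} in
theorem bijective_of_mem_flatDomain {x y : S} (hy : y ∈ L.flatDomain x) :
    Function.Bijective (L.transport x y) := (interior_subset hy).1

variable {L} in
theorem cocycle_of_mem_flatDomain {x y : S} (hy : y ∈ L.flatDomain x) :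
    ∀ᶠ z in 𝓝 y, L.transport x z = L.transport y z ∘ₗ L.transport x y := (interior_subset hy).2

theorem FrameSpace.continuous_proj : Continuous (FrameSpace.proj L V₀) := by
  rw [continuous_def]
  intro U hU
  rw [FrameSpace.isOpen_iff]
  intro s e he
  filter_upwards [hU.mem_nhds he] with s' hs' e' _ using hs'

variable {L} in
/-- The transport to a point of the flat domain, as an isomorphism. -/
noncomputable def transportEquiv {x y : S} (hy : y ∈ L.flatDomain x) :
    L.Fiber x ≃ₗ[ℝ] L.Fiber y :=
  LinearEquiv.ofBijective (L.transport x y) (bijective_of_mem_flatDomain hy)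

/-- The frames over the flat domain of `x` are the pairs of a point there and a frame at `x`. -/
noncomputable def FrameSpace.localEquiv (x : S) :
    FrameSpace.proj L V₀ ⁻¹' L.flatDomain x ≃ L.flatDomain x × (L.Fiber x ≃ₗ[ℝ] V₀) where
  toFun z := (⟨z.1.1, z.2⟩, (transportEquiv z.2).trans z.1.2)
  invFun z := ⟨⟨z.1.1, (transportEquiv z.1.2).symm.trans z.2⟩, z.1.2⟩
  left_inv := by
    rintro ⟨⟨s, e⟩, hs⟩
    refine Subtype.ext (congrArg (Sigma.mk s) ?_)
    ext u
    exact congrArg e ((transportEquiv (L := L) hs).apply_symm_apply u)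
  right_inv := by
    rintro ⟨⟨s, hs⟩, e⟩
    refine Prod.ext rfl ?_
    ext u
    exact congrArg e ((transportEquiv (L := L) hs).symm_apply_apply u)

/-- The space of frames is a covering of the base. -/
theorem FrameSpace.isCoveringMap : IsCoveringMap (FrameSpace.proj L V₀) := by
  intro x
  let : TopologicalSpace (L.Fiber x ≃ₗ[ℝ] V₀) := ⊥
  have : DiscreteTopology (L.Fiber x ≃ₗ[ℝ] V₀) := ⟨rfl⟩
  have hpre := (L.isOpen_flatDomain x).preimage (FrameSpace.continuous_proj L V₀)
  refine IsEvenlyCovered.to_isEvenlyCovered_preimage (I := L.Fiber x ≃ₗ[ℝ] V₀)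
    ⟨inferInstance, L.flatDomain x, L.mem_flatDomain x, L.isOpen_flatDomain x, hpre,
      ⟨FrameSpace.localEquiv L V₀ x, ?_, ?_⟩, fun _ => rfl⟩
  · refine Continuous.prodMk ?_ (continuous_discrete_rng.2 fun e₀ => ?_)
    · exact Continuous.subtype_mk
        ((FrameSpace.continuous_proj L V₀).comp continuous_subtype_val) _
    -- By the cocycle relation, parallel frames near `s` pull back to one and the same frame at `x`,
    -- so the discrete coordinate is locally constant.
    · rw [hpre.isOpenEmbedding_subtypeVal.isOpen_iff_image_isOpen, FrameSpace.isOpen_iff]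
      rintro s e ⟨⟨⟨s, e⟩, hs⟩, he₀, h⟩
      cases h
      filter_upwards [cocycle_of_mem_flatDomain hs, (L.isOpen_flatDomain x).mem_nhds hs] with
        s' hs' hs'' e' he'
      refine ⟨⟨⟨s', e'⟩, hs''⟩, ?_, rfl⟩
      rw [Set.mem_preimage, Set.mem_singleton_iff] at he₀ ⊢
      rw [← he₀]
      ext u
      have h1 := LinearMap.congr_fun hs' u
      have h2 := LinearMap.congr_fun he' (L.transport x s u)
      exact (congrArg e' h1).trans h2
  · rw [continuous_def]
    intro _ hU
    obtain ⟨O, hO, rfl⟩ := isOpen_induced_iff.1 hU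
    rw [isOpen_iff_mem_nhds]
    rintro ⟨⟨s, hs⟩, e⟩ he
    have h1 := FrameSpace.isOpen_iff.1 hO s _ he
    -- Conversely, the frames obtained at nearby points from a fixed frame at `x` are parallel, so
    -- they remain in the open set `O`.
    have h2 : ∀ᶠ s' in 𝓝 s, ∀ hs' : s' ∈ L.flatDomain x,
        (⟨s', (transportEquiv hs').symm.trans e⟩ : FrameSpace L V₀) ∈ O := by
      filter_upwards [h1, cocycle_of_mem_flatDomain hs] with s' h1 hc hs'
      refine h1 _ ?_
      ext u
      obtain ⟨u, rfl⟩ := (transportEquiv hs).surjective u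
      have h3 : L.transport s s' (transportEquiv hs u) = transportEquiv hs' u :=
        (LinearMap.congr_fun hc u).symm
      simp [h3]
    rw [nhds_prod_eq, nhds_discrete (L.Fiber x ≃ₗ[ℝ] V₀), Filter.prod_pure, Filter.mem_map,
      nhds_subtype_eq_comap]
    exact Filter.mem_of_superset (Filter.preimage_mem_comap h2) fun y hy => hy y.2

end Frames

/-- The pullback of a local system to a simply connected space is trivial. -/
theorem exists_flat_trivialization {S : Type u} [TopologicalSpace S] (L : LocalSystem.{u, w} S)
    {T : Type*} [TopologicalSpace T] [SimplyConnectedSpace T] [LocallyPathConnectedSpace T]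
    {π : T → S} (hπ : Continuous π) (t₀ : T) :
    ∃ τ : ∀ t, L.Fiber (π t) ≃ₗ[ℝ] L.Fiber (π t₀), τ t₀ = LinearEquiv.refl ℝ _ ∧
      ∀ t, ∀ᶠ t' in 𝓝 t, (τ t').toLinearMap ∘ₗ L.transport (π t) (π t') = (τ t).toLinearMap := by
  -- The trivialization is the lift of `π` to the covering by frames that starts at the identity
  -- frame.
  obtain ⟨f, ⟨hf₀, hf⟩, -⟩ :=
    (FrameSpace.isCoveringMap L (L.Fiber (π t₀))).existsUnique_continuousMap_lifts ⟨π, hπ⟩ t₀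
      (⟨π t₀, LinearEquiv.refl ℝ _⟩ : FrameSpace L (L.Fiber (π t₀))) rfl
  have hex : ∀ t, ∃ e : L.Fiber (π t) ≃ₗ[ℝ] L.Fiber (π t₀),
      f t = (⟨π t, e⟩ : FrameSpace L (L.Fiber (π t₀))) := by
    intro t
    have ht : (f t).1 = π t := congrFun hf t
    rw [← ht]
    exact ⟨(f t).2, rfl⟩
  choose τ hτ using hex
  refine ⟨τ, ?_, fun t => ?_⟩
  · have h := (hτ t₀).symm.trans hf₀
    exact eq_of_heq (Sigma.mk.inj h).2
  -- The sheet of frames parallel to `τ t` is open; continuity of the lift keeps it in this sheet,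
  -- which is flatness.
  · let O : Set (FrameSpace L (L.Fiber (π t₀))) := {z | z.1 ∈ L.flatDomain (π t) ∧
      z.2.toLinearMap ∘ₗ L.transport (π t) z.1 = (τ t).toLinearMap}
    have hO : IsOpen O := by
      rw [FrameSpace.isOpen_iff]
      rintro s e ⟨hs, he⟩
      filter_upwards [cocycle_of_mem_flatDomain hs, (L.isOpen_flatDomain (π t)).mem_nhds hs] with
        s' hs' hs'' e' he'
      refine ⟨hs'', ?_⟩
      rw [← he, ← he', LinearMap.comp_assoc, ← hs']
    have htO : f t ∈ O := by
      rw [hτ]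
      exact ⟨L.mem_flatDomain _, by rw [L.transport_self, LinearMap.comp_id]⟩
    filter_upwards [f.continuous.continuousAt.eventually (hO.mem_nhds htO)] with t' ht'
    rw [hτ] at ht'
    exact ht'.2

end LocalSystem

/-! ### The period map -/

theorem locallyPathConnectedSpace_of_isLocalHomeomorph {T S : Type*} [TopologicalSpace T]
    [TopologicalSpace S] [LocallyPathConnectedSpace S] {π : T → S} (hπ : IsLocalHomeomorph π) :
    LocallyPathConnectedSpace T := by
  choose e he _ using hπ
  let : ChartedSpace S T :=
    { atlas := Set.univ
      chartAt := e
      mem_chart_source := he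
      chart_mem_atlas := fun _ => Set.mem_univ _ }
  exact ChartedSpace.locallyPathConnectedSpace S T

section Variations

variable {E : Type v} [NormedAddCommGroup E] [NormedSpace ℂ E]
variable {S : Type u} [TopologicalSpace S] [ChartedSpace E S]

/-- Applied to the filtrations induced on `Gr^W_k`, this makes the Hodge numbers constant on a
connected base. -/
theorem IsHolomorphicSubbundle.isLocallyConstant_finrank {L : LocalSystem.{u, w} S}
    {B : ∀ x, Submodule ℂ (ℂ ⊗[ℝ] L.Fiber x)} (hB : IsHolomorphicSubbundle E L B) :
    IsLocallyConstant fun x => Module.finrank ℂ (B x) := by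
  rw [IsLocallyConstant.iff_eventually_eq]
  intro x
  obtain ⟨m, e, -, h⟩ := hB x
  have key : ∀ᶠ y in 𝓝 x, Module.finrank ℂ (B y) = m := by
    filter_upwards [h, L.bijective x] with y hy hb
    rw [hy.2, LinearEquiv.finrank_eq (Submodule.equivMapOfInjective _
      (baseChange_injective hb.1) _).symm, finrank_span_eq_card hy.1, Fintype.card_fin]
  filter_upwards [key] with y hy
  rw [hy, key.self_of_nhds]

/-- A holomorphic subbundle, moved to a fixed space by a flat trivialization, varies
continuously. -/
theorem IsHolomorphicSubbundle.continuous_map {L : LocalSystem.{u, w} S}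
    {B : ∀ x, Submodule ℂ (ℂ ⊗[ℝ] L.Fiber x)} (hB : IsHolomorphicSubbundle E L B)
    {T : Type*} [TopologicalSpace T] {π : T → S} (hπ : Continuous π)
    {V₀ : Type*} [AddCommGroup V₀] [Module ℝ V₀] [FiniteDimensional ℝ V₀]
    {τ : ∀ t, L.Fiber (π t) ≃ₗ[ℝ] V₀}
    (hτ : ∀ t, ∀ᶠ t' in 𝓝 t,
      (τ t').toLinearMap ∘ₗ L.transport (π t) (π t') = (τ t).toLinearMap) :
    @Continuous _ _ _ (grassmannTopology _)
      fun t => (B (π t)).map ((τ t).toLinearMap.baseChange ℂ) := by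
  let : TopologicalSpace (ℂ ⊗[ℝ] V₀) := moduleTopology ℂ _
  have : IsModuleTopology ℂ (ℂ ⊗[ℝ] V₀) := ⟨rfl⟩
  let := grassmannTopology (ℂ ⊗[ℝ] V₀)
  rw [continuous_iff_continuousAt]
  intro t
  obtain ⟨m, e, hol, h⟩ := hB (π t)
  -- Only `τ` at the fixed point `t` appears: by flatness, transport to `π t'` followed by `τ t'` is
  -- `τ t`.
  let v : T → Fin m → ℂ ⊗[ℝ] V₀ := fun t' i => (τ t).toLinearMap.baseChange ℂ (e i (π t'))
  have hv : ContinuousAt v t := by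
    refine continuousAt_pi.2 fun i => continuousAt_of_dual fun φ => ?_
    exact ((hol i).self_of_nhds
      (φ ∘ₗ (τ t).toLinearMap.baseChange ℂ)).continuousAt.comp hπ.continuousAt
  have hspan : ∀ᶠ t' in 𝓝 t, (B (π t')).map ((τ t').toLinearMap.baseChange ℂ) =
      Submodule.span ℂ (Set.range (v t')) := by
    filter_upwards [hτ t, hπ.continuousAt.eventually h] with t' h1 h2
    rw [h2.2, ← Submodule.map_comp, ← LinearMap.baseChange_comp, h1, Submodule.map_span,
      ← Set.range_comp]
    rfl
  have hli : LinearIndependent ℂ (v t) :=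
    h.self_of_nhds.1.map' _ (LinearMap.ker_eq_bot.2 (baseChange_equiv_injective (τ t)))
  have hlim := tendsto_grassmann_span hv hli
  rw [ContinuousAt, hspan.self_of_nhds]
  exact hlim.congr' (hspan.mono fun _ h => h.symm)

namespace GradedPolarizedVMHS

variable (𝒱 : GradedPolarizedVMHS.{u, v, w} E S)

theorem isFiniteIncreasing_W (x : S) : IsFiniteIncreasing (𝒱.W x) :=
  ⟨𝒱.W_monotone x, 𝒱.W_exists_top x, 𝒱.W_exists_bot x⟩

theorem isGradedPolarizedMHS (x : S) :
    IsGradedPolarizedMHS (𝒱.W x) (fun k => 𝒱.Q k x) (𝒱.F x) :=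
  ⟨𝒱.F_finite x, fun k => (𝒱.graded k).hodge x⟩

theorem hodgeNumber_eq_of_connected [PreconnectedSpace S] (x y : S) (p q : ℤ) :
    hodgeNumber (𝒱.W x) (𝒱.F x) p q = hodgeNumber (𝒱.W y) (𝒱.F y) p q := by
  have h : ∀ r, Module.finrank ℂ (inducedGrW (𝒱.W x) (𝒱.F x) (p + q) r) =
      Module.finrank ℂ (inducedGrW (𝒱.W y) (𝒱.F y) (p + q) r) := fun r =>
    ((𝒱.graded (p + q)).subbundle r).isLocallyConstant_finrank.apply_eq_of_preconnectedSpace x y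
  have h1 := hodgeNumber_eq (𝒱.W x) (𝒱.F_finite x).antitone p q
  have h2 := hodgeNumber_eq (𝒱.W y) (𝒱.F_finite y).antitone p q
  rw [h, h, ← h2] at h1
  exact_mod_cast h1

theorem map_W_eq {T : Type*} [TopologicalSpace T] [PreconnectedSpace T] {π : T → S}
    (hπ : Continuous π) {t₀ : T} {τ : ∀ t, 𝒱.L.Fiber (π t) ≃ₗ[ℝ] 𝒱.L.Fiber (π t₀)}
    (hτ₀ : τ t₀ = LinearEquiv.refl ℝ _)
    (hτ : ∀ t, ∀ᶠ t' in 𝓝 t,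
      (τ t').toLinearMap ∘ₗ 𝒱.L.transport (π t) (π t') = (τ t).toLinearMap)
    (t : T) (k : ℤ) :
    (𝒱.W (π t) k).map (τ t).toLinearMap = 𝒱.W (π t₀) k := by
  have h : IsLocallyConstant fun t => (𝒱.W (π t) k).map (τ t).toLinearMap := by
    rw [IsLocallyConstant.iff_eventually_eq]
    intro t
    filter_upwards [hτ t, hπ.continuousAt.eventually (𝒱.W_subsystem k (π t))] with t' h1 h2
    rw [← h2, ← Submodule.map_comp, h1]
  rw [h.apply_eq_of_preconnectedSpace t t₀, hτ₀]
  exact Submodule.map_id _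

/-- Moved to the fixed space `Gr^W_k` at `π t₀`, the forms are locally constant in `t`, hence
constant, and at `t₀` nothing is moved. -/
theorem form_grEquiv_eq {T : Type*} [TopologicalSpace T] [PreconnectedSpace T] {π : T → S}
    (hπ : Continuous π) {t₀ : T} {τ : ∀ t, 𝒱.L.Fiber (π t) ≃ₗ[ℝ] 𝒱.L.Fiber (π t₀)}
    (hτ₀ : τ t₀ = LinearEquiv.refl ℝ _)
    (hτ : ∀ t, ∀ᶠ t' in 𝓝 t,
      (τ t').toLinearMap ∘ₗ 𝒱.L.transport (π t) (π t') = (τ t).toLinearMap)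
    (hW : ∀ t k, (𝒱.W (π t) k).map (τ t).toLinearMap = 𝒱.W (π t₀) k)
    (t : T) (k : ℤ) (u v : GrW (𝒱.W (π t)) k) :
    𝒱.Q k (π t₀) (grEquiv (τ t) (hW t) k u) (grEquiv (τ t) (hW t) k v) = 𝒱.Q k (π t) u v := by
  let g : ∀ t, GrW (𝒱.W (π t)) k ≃ₗ[ℝ] GrW (𝒱.W (π t₀)) k := fun t => grEquiv (τ t) (hW t) k
  have hg : ∀ t, ∀ᶠ t' in 𝓝 t, ∀ u, g t' (𝒱.L.grTransport 𝒱.W k (π t) (π t') u) = g t u := by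
    intro t
    filter_upwards [hτ t, hπ.continuousAt.eventually (𝒱.W_subsystem k (π t)),
      hπ.continuousAt.eventually (𝒱.W_subsystem (k - 1) (π t))] with t' h1 h2 h3 u
    obtain ⟨u, rfl⟩ := Submodule.mkQ_surjective _ u
    rw [LocalSystem.grTransport, dif_pos ⟨Submodule.map_le_iff_le_comap.1 h2.le,
      Submodule.map_le_iff_le_comap.1 h3.le⟩]
    exact congrArg (Submodule.Quotient.mk (p := (𝒱.W (π t₀) (k - 1)).submoduleOf _))
      (Subtype.ext (LinearMap.congr_fun h1 u.1))
  have h : IsLocallyConstant fun t =>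
      (𝒱.Q k (π t)).compl₁₂ (g t).symm.toLinearMap (g t).symm.toLinearMap := by
    rw [IsLocallyConstant.iff_eventually_eq]
    intro t
    filter_upwards [hg t, hπ.continuousAt.eventually ((𝒱.graded k).flat (π t))] with t' h1 h2
    refine LinearMap.ext₂ fun u v => ?_
    obtain ⟨u, rfl⟩ := (g t).surjective u
    obtain ⟨v, rfl⟩ := (g t).surjective v
    have h3 : ∀ u, (g t').symm (g t u) = 𝒱.L.grTransport 𝒱.W k (π t) (π t') u := fun u => by
      rw [← h1, LinearEquiv.symm_apply_apply]
    simp only [LinearMap.compl₁₂_apply, LinearEquiv.coe_coe, LinearEquiv.symm_apply_apply, h3]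
    exact h2 u v
  have hg₀ : ∀ u, g t₀ u = u := by
    intro u
    obtain ⟨u, rfl⟩ := Submodule.mkQ_surjective _ u
    refine congrArg (Submodule.Quotient.mk (p := (𝒱.W (π t₀) (k - 1)).submoduleOf _))
      (Subtype.ext ?_)
    change τ t₀ u.1 = u.1
    rw [hτ₀]
    rfl
  have hg₀' : ∀ u, (g t₀).symm u = u := fun u => (g t₀).injective (by
    rw [LinearEquiv.apply_symm_apply, hg₀])
  have h1 := h.apply_eq_of_preconnectedSpace t t₀
  have h2 := LinearMap.congr_fun (LinearMap.congr_fun h1 (g t u)) (g t v)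
  simp only [LinearMap.compl₁₂_apply, LinearEquiv.coe_coe, LinearEquiv.symm_apply_apply,
    hg₀'] at h2
  exact h2.symm

/-- The lifted period map exists, is continuous, and is compatible with the level of
splitting. -/
theorem exists_periodMap [PreconnectedSpace S] {T : Type*} [TopologicalSpace T]
    [SimplyConnectedSpace T] [LocallyPathConnectedSpace T] {π : T → S} (hπ : Continuous π)
    (t₀ : T) : ∃ Φ : T → 𝒱.Classifying (π t₀), Continuous Φ ∧ 𝒱.IsPeriodMap π t₀ Φ ∧
      ∀ t, 𝒱.alpha (π t) = 𝒱.alphaM (π t₀) (Φ t) := by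
  obtain ⟨τ, hτ₀, hτ⟩ := 𝒱.L.exists_flat_trivialization hπ t₀
  have hW := 𝒱.map_W_eq hπ hτ₀ hτ
  let Φ : T → 𝒱.Classifying (π t₀) := fun t => ⟨mapFil (τ t) (𝒱.F (π t)),
    (𝒱.isGradedPolarizedMHS (π t)).mapFil (τ t) (hW t) (𝒱.form_grEquiv_eq hπ hτ₀ hτ hW t),
    fun p q => (hodgeNumber_mapFil (τ t) (hW t) (𝒱.F_finite _) p q).trans
      (𝒱.hodgeNumber_eq_of_connected _ _ p q)⟩
  let := grassmannTopology (ℂ ⊗[ℝ] 𝒱.L.Fiber (π t₀))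
  refine ⟨Φ, ?_, ⟨τ, hτ₀, hτ, hW, fun _ _ => rfl⟩,
    fun t => (splitLevel_mapFil (τ t) (hW t) (𝒱.F_finite _)).symm⟩
  exact continuous_induced_rng.2 (continuous_pi fun p => (𝒱.F_subbundle p).continuous_map hπ hτ)

end GradedPolarizedVMHS

end Variations

end SplitLevel

theorem mainTheorem10 {E : Type*} [NormedAddCommGroup E] [NormedSpace ℂ E] [FiniteDimensional ℂ E]
    {S : Type*} [TopologicalSpace S] [T2Space S] [ConnectedSpace S] [ChartedSpace E S]
    [IsManifold 𝓘(ℂ, E) ω S]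
    (𝒱 : SplitLevel.GradedPolarizedVMHS E S)
    {T : Type*} [TopologicalSpace T] [SimplyConnectedSpace T] (π : T → S) (hπ : IsCoveringMap π)
    (t₀ : T) :
    -- on the product of the classifying space with itself
    SplitLevel.IsSemicontinuousLevel (𝒱.alphaMM (π t₀)) ∧
    -- on the classifying space
    SplitLevel.IsSemicontinuousLevel (𝒱.alphaM (π t₀)) ∧
    -- the universal cover maps to the classifying space, and `α` is pulled back from there
    (∃ Φ : T → 𝒱.Classifying (π t₀), Continuous Φ ∧ 𝒱.IsPeriodMap π t₀ Φ ∧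
      ∀ t, 𝒱.alpha (π t) = 𝒱.alphaM (π t₀) (Φ t)) ∧
    -- on the universal cover
    SplitLevel.IsSemicontinuousLevel (fun t => 𝒱.alpha (π t)) := by
  have hW := 𝒱.isFiniteIncreasing_W (π t₀)
  have hbox := SplitLevel.exists_supportedInBox_hodgeNumber hW (𝒱.F_finite (π t₀))
  -- Local path connectedness, inherited from `E` by `S` and then by its covering, is needed for
  -- lifting to the covering of frames.
  have : LocallyPathConnectedSpace S := ChartedSpace.locallyPathConnectedSpace E S
  have : LocallyPathConnectedSpace T :=
    SplitLevel.locallyPathConnectedSpace_of_isLocalHomeomorph hπ.isLocalHomeomorph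
  have hM : SplitLevel.IsSemicontinuousLevel (𝒱.alphaM (π t₀)) :=
    SplitLevel.isSemicontinuousLevel_splitLevel_classifyingSpace hW hbox
  obtain ⟨Φ, hΦ, hper, hα⟩ := 𝒱.exists_periodMap hπ.continuous t₀
  refine ⟨SplitLevel.isSemicontinuousLevel_pairLevel_classifyingSpace hW hbox, hM,
    ⟨Φ, hΦ, hper, hα⟩, ?_⟩
  rw [funext hα]
  exact hM.comp hΦ
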